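/- Conventions. For a commutative ring $R$ and $h\in R$ let $R[h]=\{r\in R: rh=0\}$. A square matrix is alternating if it is skew-symmetric with zero diagonal. If $h$ divides every entry of an $n\times n$ matrix $C$ over $R$, then $C/h$ denotes the matrix of quotients, which is well defined as a matrix over $R/R[h]$ (for $R=\mathbb Z/a\mathbb Z$ one has $R/R[h]\cong\mathbb Z/\tfrac{a}{\gcd(a,h)}\mathbb Z$; if $h$ is not a zero divisor, $R/R[h]=R$). The cokernel of an $n\times n$ matrix $M$ over $R$ is $\operatorname{coker}(M)=R^n/MR^n$. An $R$-valued random variable $N$ is $\varepsilon$-balanced if $\mathbb P[N\equiv r \pmod{\mathfrak p}]\le 1-\varepsilon$ for every maximal ideal $\mathfrak p$ of $R$ and every $r\in R/\mathfrak p$. For an alternating $n\times n$ matrix $C$ over $R$, an $\varepsilon$-balanced $C$-symmetric matrix is a random $n\times n$ matrix $X$ over $R$ with $X-X^{\intercal}=C$ almost surely, whose entries on and above the diagonal are independent and $\varepsilon$-balanced. $\#\operatorname{Sur}(A,G)$ is the number of surjective group homomorphisms $A\to G$, $G[h]=\{x\in G: hx=0\}$, and $\wedge^2G[h]$ is the exterior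 square over $\mathbb Z$ of the group $G[h]$. (1) Let $a\ge 1$ be an integer, $G$ a finite abelian group of exponent dividing $a$, and $\varepsilon>0$. There are constants $K,c>0$, depending only on $a$, $G$ and $\varepsilon$, such that the following holds. Let $C$ be an alternating $n\times n$ matrix over $R=\mathbb Z/a\mathbb Z$, let $h$ be an integer whose class in $R$ is a greatest common divisor of the entries of $C$, and suppose that $\operatorname{coker}(C/h)$ is generated by $g$ elements over $R/R[h]$. If $X$ is an $\varepsilon$-balanced $C$-symmetric matrix, then \[\bigl|\mathbb E[\#\operatorname{Sur}(\operatorname{coker}(X),G)]-|\wedge^2G[h]|\bigr|\le K\,(e^{-cn}+2^{g-n}).\] (2) Let $R=\mathbb Z/a\mathbb Z$ with $a\ge1$ (respectively $R=\mathbb Z$, or $R=\mathbb Z_p$ with $p$ prime), let $G$ be a finite abelian group of exponent dividing $a$ (respectively any finite abelian group, or any finite abelian $p$-group), and let $\varepsilon>0$. For each $n$ let $C_n$ be an alternating $n\times n$ matrix over $R$, let $h$ be an integer dividing all entries of $C_n$ for every $n$, suppose that $\operatorname{coker}(C_n/h)$ is generated by $g_n$ elements over $R/R[h]$, and let $X_n$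 be an $\varepsilon$-balanced $C_n$-symmetric matrix over $R$. If $n-g_n\to\infty$, then \[\lim_{n\to\infty}\mathbb E[\#\operatorname{Sur}(\operatorname{coker}(X_n),G)]=|\wedge^2G[h]|.\] -/

import Mathlib

open MeasureTheory ProbabilityTheory Filter Topology

universe u v

/-- The Borel σ-algebra of the `p`-adic integers. (`ℤ` and `ZMod a` carry the discrete one.) -/
noncomputable instance PadicInt.instMeasurableSpaceBorel (p : ℕ) [Fact p.Prime] :
    MeasurableSpace ℤ_[p] :=
  borel ℤ_[p]

namespace CSym

/-- A square matrix is alternating if it is skew-symmetric with zero diagonal. -/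
def IsAlternating {R : Type*} [CommRing R] {n : ℕ} (C : Matrix (Fin n) (Fin n) R) : Prop :=
  C.transpose = -C ∧ ∀ i, C i i = 0

/-- The cokernel `R ^ n / M (R ^ n)`. -/
abbrev Coker {R : Type*} [CommRing R] {n : ℕ} (M : Matrix (Fin n) (Fin n) R) : Type _ :=
  (Fin n → R) ⧸ LinearMap.range M.mulVecLin

/-- The module `M` can be generated by `g` elements over `R`. -/
def GeneratedBy (R : Type*) [CommRing R] (M : Type*) [AddCommGroup M] [Module R M] (g : ℕ) :
    Prop :=
  ∃ v : Fin g → M, Submodule.span R (Set.range v) = ⊤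

/-- The element `h` is a greatest common divisor of the entries of `C`. -/
def IsGCDOfEntries {R : Type*} [CommRing R] {n : ℕ} (h : R) (C : Matrix (Fin n) (Fin n) R) :
    Prop :=
  (∀ i j, h ∣ C i j) ∧ ∀ d : R, (∀ i j, d ∣ C i j) → d ∣ h

/-- `R / R[h]`, where `R[h] = {r | r * h = 0}`. If `h` is a non-zero-divisor this is `R`;
for `R = ℤ / a` it is `ℤ / (a / gcd a h)`. -/
abbrev ModTorsion (R : Type*) [CommRing R] (h : R) : Type _ := R ⧸ Ideal.torsionOf R R h

/-- The matrix `C / h`. The quotients of the entries of `C` by `h` are determined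
exactly up to `R[h]`, so that `C / h` is a matrix over `R / R[h]`. -/
noncomputable def divBy {R : Type*} [CommRing R] {n : ℕ} (C : Matrix (Fin n) (Fin n) R) (h : R)
    (hC : ∀ i j, h ∣ C i j) : Matrix (Fin n) (Fin n) (ModTorsion R h) :=
  fun i j => Ideal.Quotient.mk _ (hC i j).choose

/-- `C / h` does not depend on the choices made in its definition. -/
theorem divBy_eq {R : Type*} [CommRing R] {n : ℕ} (C D : Matrix (Fin n) (Fin n) R) (h : R)
    (hC : ∀ i j, h ∣ C i j) (hD : C = h • D) :
    divBy C h hC = D.map (Ideal.Quotient.mk (Ideal.torsionOf R R h)) := by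
  ext i j
  rw [divBy, Matrix.map_apply, Ideal.Quotient.eq, Ideal.mem_torsionOf_iff]
  have h1 := (hC i j).choose_spec
  have h2 : C i j = h * D i j := by rw [hD]; rfl
  rw [smul_eq_mul, sub_mul, mul_comm _ h, mul_comm _ h, ← h1, ← h2, sub_self]

/-- An `R`-valued random variable is `ε`-balanced if no residue class modulo a maximal ideal
has probability larger than `1 - ε`. -/
def IsBalanced {R : Type*} [CommRing R] {Ω : Type*} [MeasurableSpace Ω] (P : Measure Ω)
    (ε : ℝ) (N : Ω → R) : Prop :=
  ∀ 𝔭 : Ideal R, 𝔭.IsMaximal → ∀ r : R ⧸ 𝔭,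
    P.real {ω | Ideal.Quotient.mk 𝔭 (N ω) = r} ≤ 1 - ε

/-- `X` is an `ε`-balanced random `C`-symmetric matrix: almost surely `X - Xᵀ = C`, and the
entries on and above the diagonal are independent `ε`-balanced random variables. -/
structure IsBalancedCSymmetric {R : Type*} [CommRing R] [MeasurableSpace R] {n : ℕ}
    {Ω : Type*} [MeasurableSpace Ω] (P : Measure Ω) (ε : ℝ) (C : Matrix (Fin n) (Fin n) R)
    (X : Ω → Matrix (Fin n) (Fin n) R) : Prop where
  csymm : ∀ᵐ ω ∂P, X ω - (X ω).transpose = C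
  measurable : ∀ i j, i ≤ j → Measurable fun ω => X ω i j
  indep : iIndepFun (fun (q : {q : Fin n × Fin n // q.1 ≤ q.2}) ω => X ω q.1.1 q.1.2) P
  balanced : ∀ i j, i ≤ j → IsBalanced P ε fun ω => X ω i j

/-- The number of surjective group homomorphisms `A → G`. -/
noncomputable def numSur (A G : Type*) [AddCommGroup A] [AddCommGroup G] : ℕ :=
  Nat.card {f : A →+ G // Function.Surjective f}

/-- The order of `∧² (G[h])`, where `G[h]` is the subgroup of elements killed by `h`. -/
noncomputable def wedgeCard (G : Type*) [AddCommGroup G] (h : ℤ) : ℕ :=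
  Nat.card (⋀[ℤ]^2 (Submodule.torsionBy ℤ G h))

end CSym

set_option linter.unusedSectionVars false

namespace CSym

/-! ### Duality of finite abelian groups with values in `ZMod a` -/

section Duality

/-! A surjection from the cokernel onto $G$ is a generating tuple $f\in G^n$ with $\sum_i
X_{ij}f_i=0$ for all $j$ (`numSur_coker_eq`). Over $\mathbb Z/a$, Fourier inversion on $G^n$ turns
the number of these into $|G|^{-n}$ times a sum over $f$ and over $\varphi\in (G^*)^n$ of the
character at $\sum_{i,j}X_{ij}\varphi_j(f_i)$. Put $w_i=(f_i,\varphi_i)\in G\times G^*$, with the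
hyperbolic form $q(x,\varphi)=\varphi(x)$ and its polar form $b$. Eliminating the entries below the
diagonal through $X-X^{\intercal}=C$ leaves the deterministic phase
$-\sum_{i<j}C_{ij}\varphi_i(f_j)$ and independent entries with coefficients $q(w_i)$ and
$b(w_i,w_j)$ (`IsBalancedCSymmetric.phase_eq`). Balancedness makes each nonzero coefficient cost a
factor $\rho<1$, so a term is at most $\rho^{\text{weight}}$.

Nonzero weight is negligible (`exists_sum_weight_le`): either the weight is quadratic in $n$, or
nearly all $w_i$ lie in one isotropic subgroup $L$, which has order at most $|G|$
(`card_isotropic`). A smaller $L$ gives too few tuples. If $|L|=|G|$, then $L$ is its own orthogonal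
complement, and nonzero weight forces a nontrivial additive function on $L$ whose nonzero values are
penalised.

Weight zero with $f$ generating means $\varphi_i=\psi(f_i)$ for a unique alternating form $\psi$ on
$G$ (`exists_altForm`). The sum over $f$ of the remaining phase is trivial if $h\psi=0$; otherwise
it is a quadratic Gauss sum, which Weyl differencing bounds by $|G|^n2^{g-n}$ (`norm_sum_phase_le`).
The forms with $h\psi=0$ number $|\wedge^2G[h]|$ (`wedgeCard_eq`), which is the main term.

The rings $\mathbb Z$ and $\mathbb Z_p$ reduce to $\mathbb Z/a$, because the moments depend only on
$X$ modulo $a$. -/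

/-- Additive duality into $\mathbb Z/a$ is borrowed from multiplicative character theory: written
multiplicatively, $\mathbb Z/a$ is a cyclic group of roots of unity of order $a$. -/
theorem hasEnoughRootsOfUnity_zmod (a : ℕ) :
    HasEnoughRootsOfUnity (Multiplicative (ZMod a)) a where
  prim := by
    refine ⟨Multiplicative.ofAdd 1, ?_, ?_⟩
    · rw [← ofAdd_nsmul]
      simp
    · intro l hl
      rw [← ofAdd_nsmul, ofAdd_eq_one, nsmul_one] at hl
      exact (ZMod.natCast_eq_zero_iff l a).1 hl
  cyc := by
    have : IsCyclic (Multiplicative (ZMod a))ˣ :=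
      (toUnits (G := Multiplicative (ZMod a))).isCyclic.1 inferInstance
    infer_instance

variable {M : Type*} [AddCommGroup M] [Finite M] {a : ℕ} [NeZero a]

theorem hasEnoughRootsOfUnity_of_nsmul (hM : ∀ x : M, a • x = 0) :
    HasEnoughRootsOfUnity (Multiplicative (ZMod a)) (Monoid.exponent (Multiplicative M)) := by
  have := hasEnoughRootsOfUnity_zmod a
  exact HasEnoughRootsOfUnity.of_dvd _ (Monoid.exponent_dvd_of_forall_pow_eq_one hM)

/-- A finite abelian group killed by `a` is isomorphic to its dual. -/
theorem nonempty_addEquiv_dual (hM : ∀ x : M, a • x = 0) : Nonempty (M ≃+ (M →+ ZMod a)) := by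
  have := hasEnoughRootsOfUnity_of_nsmul hM
  obtain ⟨e⟩ := CommGroup.monoidHom_mulEquiv_of_hasEnoughRootsOfUnity (Multiplicative M)
    (Multiplicative (ZMod a))
  let e₁ : (Multiplicative M →* Multiplicative (ZMod a)) ≃* Multiplicative M :=
    (MulEquiv.monoidHomCongrRight (toUnits (G := Multiplicative (ZMod a)))).trans e
  exact ⟨{ toFun := fun x => AddMonoidHom.toMultiplicative.symm (e₁.symm (Multiplicative.ofAdd x))
           invFun := fun f => (e₁ (AddMonoidHom.toMultiplicative f)).toAdd
           left_inv := fun x => by simp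
           right_inv := fun f => by simp
           map_add' := fun x y => by
            rw [ofAdd_add, map_mul]; rfl }⟩

theorem exists_dual_apply_ne_zero (hM : ∀ x : M, a • x = 0) {x : M} (hx : x ≠ 0) :
    ∃ f : M →+ ZMod a, f x ≠ 0 := by
  have := hasEnoughRootsOfUnity_of_nsmul hM
  obtain ⟨f, hf⟩ := CommGroup.exists_apply_ne_one_of_hasEnoughRootsOfUnity (Multiplicative M)
    (Multiplicative (ZMod a)) (a := Multiplicative.ofAdd x) (by simpa using hx)
  refine ⟨AddMonoidHom.toMultiplicative.symm
    ((toUnits (G := Multiplicative (ZMod a))).symm.toMonoidHom.comp f), fun h => hf ?_⟩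
  apply (toUnits (G := Multiplicative (ZMod a))).symm.injective
  rw [map_one]
  exact h

theorem card_dual (hM : ∀ x : M, a • x = 0) : Nat.card (M →+ ZMod a) = Nat.card M :=
  (Nat.card_congr (nonempty_addEquiv_dual hM).some.toEquiv).symm

theorem nsmul_quotient_eq_zero (hM : ∀ x : M, a • x = 0) (H : AddSubgroup M) (x : M ⧸ H) :
    a • x = 0 := by
  induction x using QuotientAddGroup.induction_on with
  | H x => rw [← QuotientAddGroup.mk_nsmul, hM]; rfl

theorem card_dual_quotient (hM : ∀ x : M, a • x = 0) (H : AddSubgroup M) :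
    Nat.card (M ⧸ H →+ ZMod a) = Nat.card (M ⧸ H) :=
  card_dual (nsmul_quotient_eq_zero hM H)

/-- A finite abelian group maps onto its `h`-torsion with kernel the multiples of `h`. -/
theorem exists_surjective_torsionBy (hM : ∀ x : M, a • x = 0) (h : ℤ) :
    ∃ π : M →+ Submodule.torsionBy ℤ M h, Function.Surjective π ∧
      ∀ x, π x = 0 ↔ ∃ y, x = h • y := by
  let H : AddSubgroup M := (zsmulAddGroupHom (α := M) h).range
  have hmem : ∀ x : M, x ∈ H ↔ ∃ y, x = h • y := fun x => by
    simp [H, AddMonoidHom.mem_range, eq_comm]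
  obtain ⟨e⟩ := nonempty_addEquiv_dual hM
  obtain ⟨e'⟩ := nonempty_addEquiv_dual (nsmul_quotient_eq_zero hM H)
  -- Characters of $M/hM$ are the characters of $M$ killed by $h$; the noncanonical isomorphisms of
  -- $M/hM$ and $M$ with their duals turn this into $M/hM\cong M[h]$.
  let ρ : (M ⧸ H) → Submodule.torsionBy ℤ M h := fun x =>
    ⟨e.symm ((e' x).comp (QuotientAddGroup.mk' H)), by
      rw [Submodule.mem_torsionBy_iff, ← map_zsmul]
      convert map_zero e.symm
      ext y
      rw [AddMonoidHom.smul_apply, AddMonoidHom.comp_apply, ← map_zsmul, ← map_zsmul]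
      refine Eq.trans (congrArg (e' x) ?_) (map_zero (e' x))
      exact (QuotientAddGroup.eq_zero_iff _).2 ((hmem _).2 ⟨y, rfl⟩)⟩
  let ρ' : (M ⧸ H) →+ Submodule.torsionBy ℤ M h := AddMonoidHom.mk' ρ fun x y => by
    apply Subtype.ext
    change e.symm _ = e.symm _ + e.symm _
    rw [← map_add, map_add e', AddMonoidHom.add_comp]
  have inj : Function.Injective ρ' := by
    intro x y hxy
    have h1 := e.symm.injective (congrArg Subtype.val hxy)
    apply e'.injective
    ext z
    exact DFunLike.congr_fun h1 z
  refine ⟨ρ'.comp (QuotientAddGroup.mk' H), ?_, fun x => ?_⟩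
  · rintro ⟨y, hy⟩
    rw [Submodule.mem_torsionBy_iff] at hy
    let f : (M ⧸ H) →+ ZMod a := QuotientAddGroup.lift H (e y) (by
      intro x hx
      obtain ⟨z, rfl⟩ := (hmem x).1 hx
      rw [AddMonoidHom.mem_ker, map_zsmul, ← AddMonoidHom.smul_apply, ← map_zsmul, hy, map_zero]
      rfl)
    obtain ⟨x, hx⟩ := QuotientAddGroup.mk'_surjective H (e'.symm f)
    refine ⟨x, Subtype.ext ?_⟩
    change e.symm ((e' (QuotientAddGroup.mk' H x)).comp (QuotientAddGroup.mk' H)) = y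
    rw [hx, AddEquiv.apply_symm_apply, AddEquiv.symm_apply_eq]
    ext z
    rfl
  · rw [AddMonoidHom.comp_apply, map_eq_zero_iff _ inj, ← hmem]
    exact QuotientAddGroup.eq_zero_iff _

end Duality

/-! ### Alternating forms and the exterior square -/

section Wedge

variable {a : ℕ} [NeZero a] {G : Type*} [AddCommGroup G] [Module (ZMod a) G]

theorem nsmul_eq_zero_of_module (x : G) : a • x = 0 := by
  rw [← Nat.cast_smul_eq_nsmul (ZMod a), ZMod.natCast_self, zero_smul]

/-- Alternating bilinear forms on `G` with values in `ZMod a`, as maps into the dual. -/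
abbrev AltForm (a : ℕ) (G : Type*) [AddCommGroup G] [Module (ZMod a) G] :=
  {ψ : G →ₗ[ZMod a] Module.Dual (ZMod a) G // ∀ x, ψ x x = 0}

theorem AltForm.neg (ψ : AltForm a G) (x y : G) : ψ.1 x y = -ψ.1 y x := by
  have h := ψ.2 (x + y)
  simp only [map_add, LinearMap.add_apply, ψ.2, zero_add, add_zero] at h
  exact eq_neg_of_add_eq_zero_right h

/-- The exterior square is finite and killed by $a$, so it has the order of its dual, which the
universal property identifies with alternating maps. -/
theorem card_exteriorPower (M : Type*) [AddCommGroup M] [Finite M] (hM : ∀ x : M, a • x = 0) :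
    Nat.card (⋀[ℤ]^2 M) = Nat.card (M [⋀^Fin 2]→ₗ[ℤ] ZMod a) := by
  have h0 : ∀ x : ⋀[ℤ]^2 M, a • x = 0 := by
    intro x
    have : (a : ℤ) • (LinearMap.id : (⋀[ℤ]^2 M) →ₗ[ℤ] ⋀[ℤ]^2 M) = 0 := by
      apply exteriorPower.linearMap_ext
      ext v
      simp only [LinearMap.compAlternatingMap_apply, LinearMap.smul_apply, LinearMap.id_apply,
        LinearMap.zero_apply]
      have h1 := (exteriorPower.ιMulti ℤ 2 (M := M)).map_update_smul v 0 (a : ℤ) (v 0)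
      rw [Function.update_eq_self] at h1
      rw [← h1, natCast_zsmul, hM]
      congr 1
      exact (exteriorPower.ιMulti ℤ 2 (M := M)).map_coord_zero 0 (by simp)
    have h2 := DFunLike.congr_fun this x
    simpa using h2
  have : Module.Finite ℤ M := Module.Finite.of_finite
  have : Finite (⋀[ℤ]^2 M) := by
    apply Module.finite_of_fg_torsion
    intro x
    refine ⟨⟨(a : ℤ), mem_nonZeroDivisors_of_ne_zero (by exact_mod_cast NeZero.ne a)⟩, ?_⟩
    change (a : ℤ) • x = 0
    rw [natCast_zsmul, h0]
  rw [← card_dual h0, Nat.card_congr (addMonoidHomLequivInt ℤ).toEquiv]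
  exact Nat.card_congr exteriorPower.alternatingMapLinearEquiv.symm.toEquiv

/-- The order of `∧² (G[h])` counts the alternating forms on `G` killed by `h`. -/
theorem wedgeCard_eq [Finite G] (h : ℤ) :
    wedgeCard G h = Nat.card {ψ : AltForm a G // ∀ x y, (h : ZMod a) * ψ.1 x y = 0} := by
  have hG : ∀ x : G, a • x = 0 := nsmul_eq_zero_of_module
  obtain ⟨π, hπ, hker⟩ := exists_surjective_torsionBy hG h
  have hT : ∀ x : Submodule.torsionBy ℤ G h, a • x = 0 := fun x => Subtype.ext (hG x.1)
  rw [wedgeCard, card_exteriorPower _ hT]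
  let T := Submodule.torsionBy ℤ G h
  have hl : ∀ (β : T [⋀^Fin 2]→ₗ[ℤ] ZMod a) (x x' y : T),
      β ![x + x', y] = β ![x, y] + β ![x', y] := fun β x x' y => by
    have hu : ∀ t : T, Function.update ![0, y] 0 t = ![t, y] := fun t => by
      ext i; fin_cases i <;> rfl
    have := β.map_update_add ![0, y] 0 x x'
    rwa [hu, hu, hu] at this
  have hr : ∀ (β : T [⋀^Fin 2]→ₗ[ℤ] ZMod a) (x y y' : T),
      β ![x, y + y'] = β ![x, y] + β ![x, y'] := fun β x y y' => by
    have hu : ∀ t : T, Function.update ![x, 0] 1 t = ![x, t] := fun t => by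
      ext i; fin_cases i <;> rfl
    have := β.map_update_add ![x, 0] 1 y y'
    rwa [hu, hu, hu] at this
  -- Pull back along `π`. Since its kernel is $hG$, the image is exactly the set of alternating
  -- forms killed by `h`.
  let F (β : T [⋀^Fin 2]→ₗ[ℤ] ZMod a) : G →ₗ[ZMod a] Module.Dual (ZMod a) G :=
    AddMonoidHom.toZModLinearMap a <| AddMonoidHom.mk' (fun x =>
      AddMonoidHom.toZModLinearMap a <| AddMonoidHom.mk' (fun y => β ![π x, π y])
        fun y y' => by rw [map_add, hr]) fun x x' => by
      ext y
      change β ![π (x + x'), π y] = β ![π x, π y] + β ![π x', π y]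
      rw [map_add, hl]
  have hF : ∀ β x y, F β x y = β ![π x, π y] := fun _ _ _ => rfl
  refine Nat.card_congr (Equiv.ofBijective (fun β => ⟨⟨F β, fun x => ?_⟩, fun x y => ?_⟩) ⟨?_, ?_⟩)
  · rw [hF]
    exact β.map_eq_zero_of_eq _ (i := 0) (j := 1) rfl (by decide)
  · rw [← zsmul_eq_mul, ← LinearMap.smul_apply, ← map_zsmul, hF, (hker (h • x)).2 ⟨x, rfl⟩]
    exact β.map_coord_zero 0 rfl
  · intro β β' hβ
    have h1 : F β = F β' := congrArg (fun ψ => ψ.1.1) hβ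
    ext v
    obtain ⟨x, hx⟩ := hπ (v 0)
    obtain ⟨y, hy⟩ := hπ (v 1)
    have hv : v = ![π x, π y] := by
      ext i; fin_cases i <;> simp [hx, hy]
    rw [hv, ← hF, ← hF, h1]
  · rintro ⟨⟨ψ, hψ⟩, hh⟩
    have hh' : ∀ x y, (h : ZMod a) * ψ x y = 0 := hh
    have key : ∀ x x' y y', π x = π x' → π y = π y' → ψ x y = ψ x' y' := by
      intro x x' y y' hx hy
      obtain ⟨z, hz⟩ := (hker (x - x')).1 (by rw [map_sub, hx, sub_self])
      obtain ⟨w, hw⟩ := (hker (y - y')).1 (by rw [map_sub, hy, sub_self])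
      rw [sub_eq_iff_eq_add] at hz hw
      rw [hz, hw]
      simp only [map_add, LinearMap.add_apply, map_zsmul, LinearMap.smul_apply, zsmul_eq_mul, hh',
        zero_add]
    let s := Function.surjInv hπ
    have hs : ∀ t, π (s t) = t := Function.surjInv_eq hπ
    refine ⟨{ toFun := fun v => ψ (s (v 0)) (s (v 1))
              map_update_add' := ?_
              map_update_smul' := ?_
              map_eq_zero_of_eq' := ?_ }, ?_⟩
    · intro _ v i x y
      fin_cases i
      · simp only [Fin.zero_eta, Function.update_self, ne_eq, one_ne_zero, not_false_eq_true,
          Function.update_of_ne]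
        rw [← LinearMap.add_apply, ← map_add]
        exact key _ _ _ _ (by rw [map_add, hs, hs, hs]) rfl
      · simp only [Fin.mk_one, Function.update_self, ne_eq, zero_ne_one, not_false_eq_true,
          Function.update_of_ne]
        rw [← map_add]
        exact key _ _ _ _ rfl (by rw [map_add, hs, hs, hs])
    · intro _ v i c x
      fin_cases i
      · simp only [Fin.zero_eta, Function.update_self, ne_eq, one_ne_zero, not_false_eq_true,
          Function.update_of_ne]
        rw [← LinearMap.smul_apply, ← map_zsmul]
        exact key _ _ _ _ (by rw [map_zsmul, hs, hs]) rfl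
      · simp only [Fin.mk_one, Function.update_self, ne_eq, zero_ne_one, not_false_eq_true,
          Function.update_of_ne]
        rw [← map_zsmul]
        exact key _ _ _ _ rfl (by rw [map_zsmul, hs, hs])
    · intro v i j hv hij
      have h01 : v 0 = v 1 := by
        fin_cases i <;> fin_cases j <;> simp_all
      change ψ (s (v 0)) (s (v 1)) = 0
      rw [h01, hψ]
    · refine Subtype.ext (Subtype.ext ?_)
      ext x y
      rw [hF]
      exact key _ _ _ _ (hs _) (hs _)

end Wedge

/-! ### A weighted count of tuples in a quadratic group -/

section Weight

open Finset
open scoped Classical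

variable {W A : Type*} [AddCommGroup W] [AddCommGroup A]

/-- The number of nonzero values `q (w i)` and `b (w i) (w j)` with `i < j`. -/
noncomputable def weight (q : W → A) (b : W →+ W →+ A) {n : ℕ} (w : Fin n → W) : ℕ :=
  #{i | q (w i) ≠ 0} + #{p : Fin n × Fin n | p.1 < p.2 ∧ b (w p.1) (w p.2) ≠ 0}

variable {q : W → A} {b : W →+ W →+ A} {n : ℕ}

theorem weight_eq_zero (w : Fin n → W) : weight q b w = 0 ↔
    (∀ i, q (w i) = 0) ∧ ∀ i j, i < j → b (w i) (w j) = 0 := by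
  rw [weight, Nat.add_eq_zero_iff, card_eq_zero, card_eq_zero, filter_eq_empty_iff,
    filter_eq_empty_iff]
  simp

theorem card_filter_quadratic_le_weight (w : Fin n → W) : #{i | q (w i) ≠ 0} ≤ weight q b w :=
  Nat.le_add_right _ _

/-- The extra 1 pays for `j = i₀`, whose pair is not strictly increasing; every other `j` gives a
distinct pair after sorting. -/
theorem card_filter_bilin_le_weight (hb : ∀ x y, b x y = b y x) (w : Fin n → W) (i₀ : Fin n) :
    #{j | b (w i₀) (w j) ≠ 0} ≤ weight q b w + 1 := by
  have h1 : #(({j | b (w i₀) (w j) ≠ 0} : Finset (Fin n)).erase i₀) ≤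
      #{p : Fin n × Fin n | p.1 < p.2 ∧ b (w p.1) (w p.2) ≠ 0} := by
    refine card_le_card_of_injOn (fun j => if i₀ < j then (i₀, j) else (j, i₀)) ?_ ?_
    · intro j hj
      simp only [coe_erase, coe_filter, mem_univ, true_and, Set.mem_sdiff,
        Set.mem_ofPred_eq, Set.mem_singleton_iff] at hj
      dsimp only
      split_ifs with h
      · simpa using ⟨h, hj.1⟩
      · simpa using ⟨lt_of_le_of_ne (not_lt.1 h) hj.2, hb (w i₀) (w j) ▸ hj.1⟩
    · intro j _ j' _ h
      dsimp only at h
      split_ifs at h <;> simp_all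
  have h2 := pred_card_le_card_erase (s := ({j | b (w i₀) (w j) ≠ 0} : Finset (Fin n))) (a := i₀)
  have : #{p : Fin n × Fin n | p.1 < p.2 ∧ b (w p.1) (w p.2) ≠ 0} ≤ weight q b w :=
    Nat.le_add_left _ _
  omega

/-- Off-diagonal pairs come in two orders, and a nonzero diagonal value $b(w_i,w_i)=2q(w_i)$ forces
$q(w_i)\neq0$. -/
theorem card_filter_pairs_le_weight (hb : ∀ x y, b x y = b y x) (hq : ∀ x, b x x = q x + q x)
    (w : Fin n → W) :
    #{p : Fin n × Fin n | b (w p.1) (w p.2) ≠ 0} ≤ 2 * weight q b w := by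
  have hsub : ({p : Fin n × Fin n | b (w p.1) (w p.2) ≠ 0} : Finset _) ⊆
      ({i | q (w i) ≠ 0} : Finset (Fin n)).image (fun i => (i, i)) ∪
      (({p : Fin n × Fin n | p.1 < p.2 ∧ b (w p.1) (w p.2) ≠ 0} : Finset _) ∪
      ({p : Fin n × Fin n | p.1 < p.2 ∧ b (w p.1) (w p.2) ≠ 0} : Finset _).image Prod.swap) := by
    rintro ⟨i, j⟩ hp
    simp only [mem_filter, mem_univ, true_and] at hp
    simp only [mem_union, mem_image, mem_filter, mem_univ, true_and, Prod.exists]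
    rcases lt_trichotomy i j with h | h | h
    · exact Or.inr (Or.inl ⟨h, hp⟩)
    · subst h
      refine Or.inl ⟨i, fun h0 => hp ?_, rfl⟩
      rw [hq, h0, add_zero]
    · exact Or.inr (Or.inr ⟨j, i, ⟨h, hb (w i) (w j) ▸ hp⟩, rfl⟩)
  refine (card_le_card hsub).trans ?_
  refine (card_union_le _ _).trans ?_
  refine (add_le_add card_image_le ((card_union_le _ _).trans
    (add_le_add le_rfl card_image_le))).trans ?_
  rw [weight]
  omega

/-- The factor attached to `y` in the bounds for tuples that mostly lie in the subgroup `L`. -/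
noncomputable def factor (ρ t : ℝ) (L : AddSubgroup W) (l : W → A) (y : W) : ℝ :=
  t ^ (if y ∉ L then 1 else 0) * ρ ^ (if y ∈ L ∧ l y ≠ 0 then 1 else 0)

theorem factor_nonneg {ρ t : ℝ} (hρ : 0 ≤ ρ) (ht : 0 ≤ t) (L : AddSubgroup W) (l : W → A) (y : W) :
    0 ≤ factor ρ t L l y := by
  unfold factor; positivity

theorem prod_factor (ρ t : ℝ) (L : AddSubgroup W) (l : W → A) (w : Fin n → W) :
    ∏ j, factor ρ t L l (w j) = t ^ #{j | w j ∉ L} * ρ ^ #{j | w j ∈ L ∧ l (w j) ≠ 0} := by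
  simp only [factor, prod_mul_distrib, prod_pow_eq_pow_sum, card_filter]

theorem sum_factor_le [Fintype W] {ρ t : ℝ} (hρ1 : ρ ≤ 1) (ht : 0 ≤ t)
    (L : AddSubgroup W) (l : W → A) :
    ∑ y, factor ρ t L l y ≤ Nat.card L + t * Fintype.card W := by
  have h1 : ∀ y, factor ρ t L l y ≤ (if y ∈ L then 1 else 0) + t := by
    intro y
    unfold factor
    by_cases hy : y ∈ L
    · simp only [hy, not_true_eq_false, if_false, pow_zero, one_mul, true_and, if_true]
      split_ifs <;> simp <;> linarith
    · simp [hy]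
  refine (sum_le_sum fun y _ => h1 y).trans ?_
  rw [sum_add_distrib, sum_boole, sum_const, card_univ, nsmul_eq_mul, mul_comm t,
    Nat.card_eq_fintype_card, Fintype.card_subtype]

/-- A function additive on `L` and not identically zero there vanishes on at most half of `L`, so
the penalty averages at most $(1+\rho)/2$. -/
theorem sum_factor_le_of_ne_zero [Fintype W] {ρ t : ℝ} (hρ1 : ρ ≤ 1) (ht : 0 ≤ t)
    (L : AddSubgroup W) (l : W → A) (hl : ∀ x ∈ L, ∀ y ∈ L, l (x + y) = l x + l y)
    {x₀ : W} (hx₀ : x₀ ∈ L) (hlx : l x₀ ≠ 0) :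
    ∑ y, factor ρ t L l y ≤ Nat.card L * ((1 + ρ) / 2) + t * Fintype.card W := by
  have h1 : ∀ y, factor ρ t L l y ≤
      (if y ∈ L then ρ else 0) + (1 - ρ) * (if y ∈ L ∧ l y = 0 then 1 else 0) + t := by
    intro y
    unfold factor
    by_cases hy : y ∈ L
    · by_cases hly : l y = 0 <;> simp [hy, hly] <;> linarith
    · simp [hy]
  have h2 : 2 * #{y | y ∈ L ∧ l y = 0} ≤ #{y | y ∈ L} := by
    have hdisj : Disjoint ({y | y ∈ L ∧ l y = 0} : Finset W)
        (({y | y ∈ L ∧ l y = 0} : Finset W).image (x₀ + ·)) := by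
      rw [disjoint_left]
      intro y hy hy'
      obtain ⟨z, hz, rfl⟩ := mem_image.1 hy'
      simp only [mem_filter, mem_univ, true_and] at hy hz
      rw [hl _ hx₀ _ hz.1, hz.2, add_zero] at hy
      exact hlx hy.2
    have := card_le_card (s := ({y | y ∈ L ∧ l y = 0} : Finset W) ∪
      ({y | y ∈ L ∧ l y = 0} : Finset W).image (x₀ + ·)) (t := ({y | y ∈ L} : Finset W)) (by
        intro y hy
        rw [mem_union, mem_image] at hy
        simp only [mem_filter, mem_univ, true_and] at hy ⊢
        rcases hy with hy | ⟨z, hz, rfl⟩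
        · exact hy.1
        · exact L.add_mem hx₀ hz.1)
    rw [card_union_of_disjoint hdisj, card_image_of_injective _ (add_right_injective x₀)] at this
    omega
  refine (sum_le_sum fun y _ => h1 y).trans ?_
  rw [sum_add_distrib, sum_add_distrib, ← mul_sum, sum_boole, sum_const, card_univ, nsmul_eq_mul,
    mul_comm t, ← sum_filter, sum_const, nsmul_eq_mul, Nat.card_eq_fintype_card,
    Fintype.card_subtype]
  have h3 : (2 : ℝ) * #{y | y ∈ L ∧ l y = 0} ≤ #{y | y ∈ L} := by exact_mod_cast h2
  nlinarith

/-- Values that occur often enough are pairwise orthogonal, unless the weight is quadratic in `n`;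
otherwise most values lie in an isotropic subgroup. -/
theorem weight_dichotomy [Fintype W] (hb : ∀ x y, b x y = b y x) (hq : ∀ x, b x x = q x + q x)
    {δ : ℝ} (hδ : 0 ≤ δ) (w : Fin n → W) :
    δ ^ 2 * n ^ 2 / 2 ≤ weight q b w ∨
    ∃ L : AddSubgroup W, (∀ x ∈ L, ∀ y ∈ L, b x y = 0) ∧
      (#{j | w j ∉ L} : ℝ) ≤ Fintype.card W * δ * n := by
  let m : W → ℕ := fun u => #{j | w j = u}
  -- The popular values. If they are pairwise orthogonal they generate the isotropic `L`, and at
  -- most `Fintype.card W` rare values remain; two nonorthogonal popular values give at least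
  -- $(\delta n)^2$ ordered pairs with nonzero `b`.
  let T : Set W := {u | δ * n ≤ m u}
  by_cases hT : ∀ u ∈ T, ∀ v ∈ T, b u v = 0
  · right
    refine ⟨AddSubgroup.closure T, ?_, ?_⟩
    · intro x hx y hy
      induction hx, hy using AddSubgroup.closure_induction₂ with
      | mem x y hx hy => exact hT x hx y hy
      | zero_left => simp
      | zero_right => simp
      | add_left x y z _ _ _ h1 h2 => simp [h1, h2]
      | add_right x y z _ _ _ h1 h2 => simp [h1, h2]
      | neg_left x y _ _ h => simp [h]
      | neg_right x y _ _ h => simp [h]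
    · have h1 : #{j | w j ∉ AddSubgroup.closure T} ≤ ∑ u ∈ ({u | u ∉ T} : Finset W), m u := by
        have : ({j | w j ∉ AddSubgroup.closure T} : Finset (Fin n)) ⊆
            ({u | u ∉ T} : Finset W).biUnion fun u => {j | w j = u} := by
          intro j hj
          simp only [mem_filter, mem_univ, true_and, mem_biUnion, exists_eq_right'] at hj ⊢
          exact fun h => hj (AddSubgroup.subset_closure h)
        exact (card_le_card this).trans card_biUnion_le
      calc (#{j | w j ∉ AddSubgroup.closure T} : ℝ)
          ≤ ∑ u ∈ ({u | u ∉ T} : Finset W), (m u : ℝ) := by exact_mod_cast h1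
        _ ≤ ∑ u ∈ ({u | u ∉ T} : Finset W), δ * n := by
            refine sum_le_sum fun u hu => ?_
            simp only [mem_filter, mem_univ, true_and, T, Set.mem_ofPred_eq, not_le] at hu
            exact hu.le
        _ ≤ ∑ u : W, δ * n :=
            sum_le_sum_of_subset_of_nonneg (subset_univ _) fun _ _ _ => by positivity
        _ = _ := by rw [sum_const, card_univ, nsmul_eq_mul, mul_assoc]
  · left
    push Not at hT
    obtain ⟨u, hu, v, hv, huv⟩ := hT
    have h1 : m u * m v ≤ #{p : Fin n × Fin n | b (w p.1) (w p.2) ≠ 0} := by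
      rw [← card_product]
      refine card_le_card fun p hp => ?_
      simp only [mem_product, mem_filter, mem_univ, true_and] at hp ⊢
      rwa [hp.1, hp.2]
    have h2 : (m u * m v : ℝ) ≤ 2 * weight q b w := by
      exact_mod_cast h1.trans (card_filter_pairs_le_weight hb hq w)
    have h3 : (δ * n) * (δ * n) ≤ m u * m v :=
      mul_le_mul hu hv (by positivity) (by positivity)
    linarith

/-- Completing the square; it shows that $e^{-ln^2}$ beats the count $|W|^n$ with a factor $e^{-n}$
to spare. -/
theorem quadratic_exponent_le {A' l : ℝ} (hl : 0 < l) (x : ℝ) :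
    x * A' - l * x ^ 2 ≤ (A' + 1) ^ 2 / (4 * l) + -1 * x := by
  have : (A' + 1) ^ 2 / (4 * l) + -1 * x - (x * A' - l * x ^ 2) =
      (2 * l * x - (A' + 1)) ^ 2 / (4 * l) := by
    field_simp; ring
  have h2 : 0 ≤ (2 * l * x - (A' + 1)) ^ 2 / (4 * l) := by positivity
  linarith

/-- If isotropic subgroups have order less than `N`, or order `N` and equal their orthogonal
complements, then tuples of nonzero weight contribute an exponentially small part of `N ^ n`. -/
theorem exists_sum_weight_le [Fintype W] (hb : ∀ x y, b x y = b y x)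
    (hq : ∀ x, b x x = q x + q x) (hadd : ∀ x y, q (x + y) = q x + q y + b x y)
    {N : ℕ} (hN : 0 < N)
    (hiso : ∀ L : AddSubgroup W, (∀ x ∈ L, ∀ y ∈ L, b x y = 0) →
      Nat.card L < N ∨ Nat.card L = N ∧ ∀ x ∉ L, ∃ y ∈ L, b x y ≠ 0)
    {ρ : ℝ} (hρ : 0 < ρ) (hρ1 : ρ < 1) :
    ∃ K c : ℝ, 0 < K ∧ 0 < c ∧ ∀ n : ℕ,
      ∑ w : Fin n → W with weight q b w ≠ 0, ρ ^ weight q b w ≤ K * Real.exp (-c * n) * N ^ n := by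
  have hN' : (0 : ℝ) < N := by exact_mod_cast hN
  have hN1 : (1 : ℝ) ≤ N := by exact_mod_cast hN
  have hW : (0 : ℝ) < Fintype.card W := by exact_mod_cast Fintype.card_pos
  have hW1 : (1 : ℝ) ≤ Fintype.card W := by exact_mod_cast Fintype.card_pos
  let : Fintype (AddSubgroup W) := Fintype.ofFinite _
  -- `κ₀` is the saving per coordinate inside `L`: $1-1/N$ when $|L|\le N-1$, and $(1+\rho)/2$ when
  -- $|L|=N$.
  obtain ⟨κ₀, hκ₀ρ, hκ₀N, hκ₀⟩ : ∃ κ₀ : ℝ, (1 + ρ) / 2 ≤ κ₀ ∧ 1 - 1 / (N : ℝ) ≤ κ₀ ∧ κ₀ < 1 :=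
    ⟨max ((1 + ρ) / 2) (1 - 1 / N), le_max_left _ _, le_max_right _ _,
      max_lt (by linarith) (by have : 0 < 1 / (N : ℝ) := by positivity
                               linarith)⟩
  -- Values outside `L` add at most $t|W|=(1-\kappa_0)/2$ in total, which spends half of the gap and
  -- leaves the rate `κ₁` below.
  obtain ⟨t, ht⟩ : ∃ t : ℝ, t = (1 - κ₀) / 2 / Fintype.card W := ⟨_, rfl⟩
  have htW : t * Fintype.card W = (1 - κ₀) / 2 := by rw [ht]; field_simp
  have ht0 : 0 < t := by rw [ht]; have : 0 < 1 - κ₀ := by linarith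
                         positivity
  have ht1 : t < 1 := by nlinarith
  obtain ⟨κ₁, hκ₁⟩ : ∃ κ₁ : ℝ, κ₁ = (1 + κ₀) / 2 := ⟨_, rfl⟩
  have hκ₁0 : 0 < κ₁ := by linarith
  have hκ₁1 : κ₁ < 1 := by linarith
  have hlt : 0 < -Real.log t := by have := Real.log_neg ht0 ht1; linarith
  have hlκ : 0 < -Real.log κ₁ := by have := Real.log_neg hκ₁0 hκ₁1; linarith
  have hlρ : 0 < -Real.log ρ := by have := Real.log_neg hρ hρ1; linarith
  set lt := -Real.log t with hlt_def
  set lκ := -Real.log κ₁ with hlκ_def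
  -- With at most $|W|\delta n$ exceptions, undoing their factors `t` costs at most $e^{l_\kappa
  -- n/2}$, half of the gain $\kappa_1^n=e^{-l_\kappa n}$.
  obtain ⟨δ, hδ⟩ : ∃ δ : ℝ, δ = lκ / (2 * lt * Fintype.card W) := ⟨_, rfl⟩
  have hδ0 : 0 < δ := by rw [hδ]; positivity
  have hδW : Fintype.card W * δ * lt = lκ / 2 := by rw [hδ]; field_simp
  let lin : Option W → W → A := fun o => o.elim q fun x => b x
  -- The index set of a union bound, finite independently of `n`: a subgroup together with a test
  -- function, either `q` or some `b x`, for which one coordinate contributes at most $\kappa_1N$.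
  let good : Finset (AddSubgroup W × Option W) :=
    {i | ∑ y, factor ρ t i.1 (lin i.2) y ≤ κ₁ * N}
  obtain ⟨l, hl⟩ : ∃ l : ℝ, l = δ ^ 2 / 2 * -Real.log ρ := ⟨_, rfl⟩
  have hl0 : 0 < l := by rw [hl]; positivity
  have key : ∀ (n : ℕ) (w : Fin n → W), weight q b w ≠ 0 → ρ ^ weight q b w ≤
      Real.exp (-l * n ^ 2) + ∑ i ∈ good, ρ⁻¹ * Real.exp (lκ / 2 * n) *
        ∏ j, factor ρ t i.1 (lin i.2) (w j) := by
    intro n w hw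
    have hnn : ∀ i ∈ good, 0 ≤ ρ⁻¹ * Real.exp (lκ / 2 * n) *
        ∏ j, factor ρ t i.1 (lin i.2) (w j) := fun i _ =>
      mul_nonneg (by positivity) (prod_nonneg fun j _ => factor_nonneg hρ.le ht0.le _ _ _)
    rcases weight_dichotomy hb hq hδ0.le w with h | ⟨L, hL, hout⟩
    · refine le_add_of_le_of_nonneg ?_ (sum_nonneg hnn)
      rw [← Real.exp_log hρ, ← Real.exp_nat_mul, Real.exp_le_exp, hl]
      nlinarith
    · refine le_add_of_nonneg_of_le (Real.exp_pos _).le ?_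
      have main : ∀ o : Option W, (L, o) ∈ good →
          #{j | w j ∈ L ∧ lin o (w j) ≠ 0} ≤ weight q b w + 1 →
          ρ ^ weight q b w ≤ ∑ i ∈ good, ρ⁻¹ * Real.exp (lκ / 2 * n) *
            ∏ j, factor ρ t i.1 (lin i.2) (w j) := by
        intro o ho hc
        refine le_trans ?_ (single_le_sum hnn ho)
        rw [prod_factor]
        have h1 : 1 ≤ Real.exp (lκ / 2 * n) * t ^ #{j | w j ∉ L} := by
          rw [← Real.exp_log ht0, ← Real.exp_nat_mul, ← Real.exp_add, Real.one_le_exp_iff,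
            ← hδW]
          have := mul_le_mul_of_nonneg_right hout hlt.le
          rw [hlt_def] at this ⊢
          linarith
        have h2 : ρ ^ (weight q b w + 1) ≤ ρ ^ #{j | w j ∈ L ∧ lin o (w j) ≠ 0} :=
          pow_le_pow_of_le_one hρ.le hρ1.le hc
        calc ρ ^ weight q b w = ρ⁻¹ * 1 * ρ ^ (weight q b w + 1) := by
              rw [pow_succ]; field_simp
          _ ≤ ρ⁻¹ * (Real.exp (lκ / 2 * n) * t ^ #{j | w j ∉ L}) *
              ρ ^ #{j | w j ∈ L ∧ lin o (w j) ≠ 0} := by gcongr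
          _ = _ := by ring
      have hqL : ∀ x ∈ L, ∀ y ∈ L, q (x + y) = q x + q y := fun x hx y hy => by
        rw [hadd, hL x hx y hy, add_zero]
      rcases hiso L hL with hcard | ⟨hcard, hperp⟩
      · refine main none ?_ ?_
        · simp only [good, mem_filter, mem_univ, true_and]
          refine (sum_factor_le hρ1.le ht0.le L _).trans ?_
          have : (Nat.card L : ℝ) ≤ N - 1 := by
            have : (Nat.card L : ℝ) + 1 ≤ N := by exact_mod_cast hcard
            linarith
          have h3 : N * (1 - 1 / (N : ℝ)) = N - 1 := by field_simp
          rw [htW, hκ₁]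
          nlinarith
        · refine le_trans (card_le_card fun j => ?_)
            ((card_filter_quadratic_le_weight (b := b) w).trans (Nat.le_succ _))
          simp only [mem_filter, mem_univ, true_and]
          exact fun h => h.2
      · have hgood : ∀ (o : Option W) (x₀ : W), x₀ ∈ L → lin o x₀ ≠ 0 →
            (∀ x ∈ L, ∀ y ∈ L, lin o (x + y) = lin o x + lin o y) → (L, o) ∈ good := by
          intro o x₀ hx₀ hne ho
          simp only [good, mem_filter, mem_univ, true_and]
          refine (sum_factor_le_of_ne_zero hρ1.le ht0.le L _ ho hx₀ hne).trans ?_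
          rw [hcard, htW, hκ₁]
          nlinarith
        -- If all values lie in `L`, then `b` vanishes on them and nonzero weight needs some
        -- $q(w_i)\neq0$, with `q` additive on `L`. Otherwise a value $w_i$ outside `L` makes
        -- $b(w_i,\cdot)$ nontrivial on `L`.
        by_cases hall : ∀ j, w j ∈ L
        · have : ∃ i, q (w i) ≠ 0 := by
            by_contra hcon
            push Not at hcon
            apply hw
            simp [weight, hcon, hL _ (hall _) _ (hall _)]
          obtain ⟨i, hi⟩ := this
          refine main none (hgood none (w i) (hall i) hi hqL) ?_
          refine le_trans (card_le_card fun j => ?_)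
            ((card_filter_quadratic_le_weight (b := b) w).trans (Nat.le_succ _))
          simp only [mem_filter, mem_univ, true_and]
          exact fun h => h.2
        · push Not at hall
          obtain ⟨i, hi⟩ := hall
          obtain ⟨y, hy, hne⟩ := hperp _ hi
          refine main (some (w i)) (hgood _ y hy hne fun x _ y _ => map_add (b (w i)) x y) ?_
          refine le_trans (card_le_card fun j => ?_) (card_filter_bilin_le_weight hb w i)
          simp only [mem_filter, mem_univ, true_and]
          exact fun h => h.2
  refine ⟨Real.exp ((Real.log (Fintype.card W) + 1) ^ 2 / (4 * l)) + #good * ρ⁻¹,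
    min 1 (lκ / 2), by positivity, by positivity, fun n => ?_⟩
  have hsum : ∑ w : Fin n → W with weight q b w ≠ 0, ρ ^ weight q b w ≤
      (Fintype.card W : ℝ) ^ n * Real.exp (-l * n ^ 2) +
        #good * (ρ⁻¹ * Real.exp (lκ / 2 * n) * (κ₁ * N) ^ n) := by
    calc ∑ w : Fin n → W with weight q b w ≠ 0, ρ ^ weight q b w
        ≤ ∑ w : Fin n → W with weight q b w ≠ 0, (Real.exp (-l * n ^ 2) + ∑ i ∈ good,
          ρ⁻¹ * Real.exp (lκ / 2 * n) * ∏ j, factor ρ t i.1 (lin i.2) (w j)) :=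
          sum_le_sum fun w hw => key n w (mem_filter.1 hw).2
      _ ≤ ∑ w : Fin n → W, (Real.exp (-l * n ^ 2) + ∑ i ∈ good,
          ρ⁻¹ * Real.exp (lκ / 2 * n) * ∏ j, factor ρ t i.1 (lin i.2) (w j)) := by
          refine sum_le_sum_of_subset_of_nonneg (subset_univ _) fun w _ _ => ?_
          exact add_nonneg (Real.exp_pos _).le (sum_nonneg fun i _ => mul_nonneg (by positivity)
            (prod_nonneg fun j _ => factor_nonneg hρ.le ht0.le _ _ _))
      _ = (Fintype.card W : ℝ) ^ n * Real.exp (-l * n ^ 2) + ∑ i ∈ good,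
          ρ⁻¹ * Real.exp (lκ / 2 * n) * (∑ y, factor ρ t i.1 (lin i.2) y) ^ n := by
          rw [sum_add_distrib, sum_const, card_univ, Fintype.card_fun, Fintype.card_fin,
            nsmul_eq_mul, Nat.cast_pow, sum_comm]
          congr 1
          refine sum_congr rfl fun i _ => ?_
          rw [← mul_sum, Fintype.sum_pow]
      _ ≤ _ := by
          rw [← nsmul_eq_mul (#good), ← sum_const]
          gcongr with i hi
          · exact sum_nonneg fun j _ => factor_nonneg hρ.le ht0.le _ _ _
          · exact (mem_filter.1 hi).2
  refine hsum.trans ?_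
  have hn0 : (0 : ℝ) ≤ n := Nat.cast_nonneg n
  have e1 : (Fintype.card W : ℝ) ^ n * Real.exp (-l * n ^ 2) ≤
      Real.exp ((Real.log (Fintype.card W) + 1) ^ 2 / (4 * l)) *
        Real.exp (-min 1 (lκ / 2) * n) := by
    rw [← Real.exp_log hW, ← Real.exp_nat_mul, ← Real.exp_add, ← Real.exp_add, Real.exp_le_exp,
      Real.exp_log hW]
    have := quadratic_exponent_le (A' := Real.log (Fintype.card W)) hl0 (n : ℝ)
    have := mul_le_mul_of_nonneg_right (min_le_left 1 (lκ / 2)) hn0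
    linarith
  have e2 : Real.exp (lκ / 2 * n) * κ₁ ^ n ≤ Real.exp (-min 1 (lκ / 2) * n) := by
    rw [← Real.exp_log hκ₁0, ← Real.exp_nat_mul, ← Real.exp_add, Real.exp_le_exp]
    have := mul_le_mul_of_nonneg_right (min_le_right 1 (lκ / 2)) hn0
    have h4 : Real.log κ₁ = -lκ := by rw [hlκ_def, neg_neg]
    rw [h4]
    linarith
  have hNn : (1 : ℝ) ≤ (N : ℝ) ^ n := one_le_pow₀ hN1
  calc (Fintype.card W : ℝ) ^ n * Real.exp (-l * n ^ 2) +
        #good * (ρ⁻¹ * Real.exp (lκ / 2 * n) * (κ₁ * N) ^ n)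
      = (Fintype.card W : ℝ) ^ n * Real.exp (-l * n ^ 2) * 1 +
        #good * ρ⁻¹ * (Real.exp (lκ / 2 * n) * κ₁ ^ n) * N ^ n := by rw [mul_pow]; ring
    _ ≤ Real.exp ((Real.log (Fintype.card W) + 1) ^ 2 / (4 * l)) *
        Real.exp (-min 1 (lκ / 2) * n) * N ^ n +
        #good * ρ⁻¹ * Real.exp (-min 1 (lκ / 2) * n) * N ^ n := by gcongr
    _ = _ := by ring

end Weight

/-! ### The hyperbolic group `G × G*` -/

section Hyperbolic

variable {a : ℕ} [NeZero a] {G : Type*} [AddCommGroup G] [Module (ZMod a) G]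

/-- The canonical quadratic form on `G × G*`. -/
def hypQuad (w : G × Module.Dual (ZMod a) G) : ZMod a := w.2 w.1

/-- The polar form of the canonical quadratic form on `G × G*`. -/
def hypBilin : (G × Module.Dual (ZMod a) G) →+ (G × Module.Dual (ZMod a) G) →+ ZMod a :=
  AddMonoidHom.mk' (fun w => AddMonoidHom.mk' (fun w' => w.2 w'.1 + w'.2 w.1) fun x y => by
    simp only [Prod.fst_add, Prod.snd_add, map_add, LinearMap.add_apply]; ring) fun x y => by
    ext w
    simp only [Prod.fst_add, Prod.snd_add, map_add, LinearMap.add_apply, AddMonoidHom.add_apply,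
      AddMonoidHom.mk'_apply]
    ring

theorem hypBilin_apply (w w' : G × Module.Dual (ZMod a) G) :
    hypBilin w w' = w.2 w'.1 + w'.2 w.1 := rfl

theorem hypBilin_comm (w w' : G × Module.Dual (ZMod a) G) : hypBilin w w' = hypBilin w' w := by
  rw [hypBilin_apply, hypBilin_apply, add_comm]

theorem hypBilin_self (w : G × Module.Dual (ZMod a) G) :
    hypBilin w w = hypQuad w + hypQuad w := rfl

theorem hypQuad_add (x y : G × Module.Dual (ZMod a) G) :
    hypQuad (x + y) = hypQuad x + hypQuad y + hypBilin x y := by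
  simp only [hypQuad, hypBilin_apply, Prod.fst_add, Prod.snd_add, map_add, LinearMap.add_apply]
  ring

variable [Finite G]

theorem exists_linear_dual_apply_ne_zero {x : G} (hx : x ≠ 0) :
    ∃ φ : Module.Dual (ZMod a) G, φ x ≠ 0 := by
  obtain ⟨f, hf⟩ := exists_dual_apply_ne_zero (nsmul_eq_zero_of_module (a := a)) hx
  exact ⟨f.toZModLinearMap a, hf⟩

theorem card_linear_dual : Nat.card (Module.Dual (ZMod a) G) = Nat.card G := by
  rw [← card_dual (nsmul_eq_zero_of_module (a := a) (G := G))]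
  exact (Nat.card_congr (AddMonoidHom.toZModLinearMapEquiv a).toEquiv).symm

instance : Finite (Module.Dual (ZMod a) G) := DFunLike.finite _

theorem hypBilin_nondegenerate {w : G × Module.Dual (ZMod a) G}
    (hw : ∀ w', hypBilin w w' = 0) : w = 0 := by
  refine Prod.ext ?_ ?_
  · by_contra h
    obtain ⟨φ, hφ⟩ := exists_linear_dual_apply_ne_zero (a := a) h
    exact hφ (by simpa [hypBilin_apply] using hw (0, φ))
  · ext x
    simpa [hypBilin_apply] using hw (x, 0)

/-- By nondegeneracy the orthogonal complement of `L` embeds in the dual of the quotient by `L`, so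
its order is at most $|G|^2/|L|$. It contains `L`; hence $|L|\le|G|$, and equality makes `L` its own
complement. -/
theorem card_isotropic (L : AddSubgroup (G × Module.Dual (ZMod a) G))
    (hL : ∀ x ∈ L, ∀ y ∈ L, hypBilin x y = 0) :
    Nat.card L < Nat.card G ∨
      Nat.card L = Nat.card G ∧ ∀ x ∉ L, ∃ y ∈ L, hypBilin x y ≠ 0 := by
  let P : AddSubgroup (G × Module.Dual (ZMod a) G) :=
    { carrier := {x | ∀ y ∈ L, hypBilin x y = 0}
      add_mem' := fun {x y} hx hy z hz => by
        rw [map_add, AddMonoidHom.add_apply, hx z hz, hy z hz, add_zero]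
      zero_mem' := fun z _ => by simp
      neg_mem' := fun {x} hx z hz => by
        rw [map_neg, AddMonoidHom.neg_apply, hx z hz, neg_zero] }
  have hLP : L ≤ P := fun x hx y hy => hL x hx y hy
  let F : P → ((G × Module.Dual (ZMod a) G) ⧸ L →+ ZMod a) := fun x =>
    QuotientAddGroup.lift L (hypBilin x.1) fun y hy => x.2 y hy
  have hF : Function.Injective F := by
    intro x y hxy
    have h : hypBilin x.1 = hypBilin y.1 := by
      ext z
      exact DFunLike.congr_fun hxy (QuotientAddGroup.mk z)
    have h0 := hypBilin_nondegenerate (w := x.1 - y.1) fun w' => by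
      rw [map_sub, h, sub_self]; rfl
    exact Subtype.ext (sub_eq_zero.1 h0)
  have : Finite ((G × Module.Dual (ZMod a) G) ⧸ L →+ ZMod a) := DFunLike.finite _
  have h1 : Nat.card P ≤ Nat.card ((G × Module.Dual (ZMod a) G) ⧸ L) := by
    have h0 := card_dual_quotient (nsmul_eq_zero_of_module (a := a)) L
    rw [← h0]
    exact Nat.card_le_card_of_injective F hF
  have h2 := AddSubgroup.card_eq_card_quotient_mul_card_addSubgroup L
  rw [Nat.card_prod, card_linear_dual] at h2
  have h3 : Nat.card L ≤ Nat.card P :=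
    Nat.card_le_card_of_injective _ (AddSubgroup.inclusion_injective hLP)
  have hG : 0 < Nat.card G := Nat.card_pos
  have hLpos : 0 < Nat.card L := Nat.card_pos
  rcases lt_or_ge (Nat.card L) (Nat.card G) with h | h
  · exact Or.inl h
  · have h4 : Nat.card P ≤ Nat.card G := by
      by_contra hcon
      nlinarith
    refine Or.inr ⟨by omega, fun x hx => ?_⟩
    by_contra hcon
    push Not at hcon
    have : L = P := AddSubgroup.eq_of_le_of_card_ge hLP (by omega)
    exact hx (this ▸ hcon)

end Hyperbolic

/-! ### Character sums -/

section CharSum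

open Finset

variable {a : ℕ} [NeZero a] {G : Type*} [AddCommGroup G] [Module (ZMod a) G] [Fintype G]
  [DecidableEq G]

theorem sum_stdAddChar_dual [Fintype (Module.Dual (ZMod a) G)] (x : G) :
    ∑ φ : Module.Dual (ZMod a) G, ZMod.stdAddChar (φ x) =
      if x = 0 then (Fintype.card G : ℂ) else 0 := by
  classical
  have h := AddChar.sum_eq_ite
    ((ZMod.stdAddChar (N := a)).compAddMonoidHom (LinearMap.applyₗ (R := ZMod a)
      (M₂ := ZMod a) x).toAddMonoidHom)
  have hcard : Fintype.card (Module.Dual (ZMod a) G) = Fintype.card G := by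
    rw [← Nat.card_eq_fintype_card, ← Nat.card_eq_fintype_card, card_linear_dual]
  rw [hcard] at h
  refine Eq.trans h (if_congr ?_ rfl rfl)
  constructor
  · intro h0
    by_contra hx
    obtain ⟨φ, hφ⟩ := exists_linear_dual_apply_ne_zero (a := a) hx
    have := DFunLike.congr_fun h0 φ
    exact hφ (ZMod.injective_stdAddChar (this.trans (AddChar.map_zero_eq_one _).symm))
  · rintro rfl
    ext φ
    simp

theorem stdAddChar_sum {ι : Type*} (s : Finset ι) (f : ι → ZMod a) :
    ZMod.stdAddChar (∑ i ∈ s, f i) = ∏ i ∈ s, ZMod.stdAddChar (f i) :=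
  map_prod (ZMod.stdAddChar (N := a)).toMonoidHom (fun i => Multiplicative.ofAdd (f i)) s

theorem sum_stdAddChar_dual_pi [Fintype (Module.Dual (ZMod a) G)] {n : ℕ} (x : Fin n → G) :
    ∑ φ : Fin n → Module.Dual (ZMod a) G, ZMod.stdAddChar (∑ j, φ j (x j)) =
      if x = 0 then (Fintype.card G : ℂ) ^ n else 0 := by
  simp only [stdAddChar_sum]
  rw [← Fintype.prod_sum (fun j (φ : Module.Dual (ZMod a) G) => ZMod.stdAddChar (φ (x j)))]
  simp only [sum_stdAddChar_dual]
  split_ifs with h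
  · simp [h]
  · obtain ⟨j, hj⟩ := Function.ne_iff.1 h
    exact prod_eq_zero (mem_univ j) (by simpa using hj)

theorem norm_stdAddChar (x : ZMod a) : ‖ZMod.stdAddChar x‖ = 1 := by
  rw [ZMod.stdAddChar_apply, Circle.norm_coe]

/-- A bound for the sum of the values of a quadratic phase on a finite abelian group. -/
theorem norm_sum_quadratic_le {M : Type*} [AddCommGroup M] [Fintype M] (Q : M → ZMod a)
    (B : M →+ M →+ ZMod a) (hQ : ∀ x d, Q (x + d) = Q x + Q d + B d x) :
    ‖∑ x, ZMod.stdAddChar (Q x)‖ ^ 2 ≤ Fintype.card M * Nat.card {d // ∀ x, B d x = 0} := by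
  classical
  -- Weyl differencing: substituting $y=x+d$ leaves a linear phase in $x$, whose sum vanishes unless
  -- $B(d,\cdot)=0$.
  have h1 : (∑ x, ZMod.stdAddChar (Q x)) * (starRingEnd ℂ) (∑ x, ZMod.stdAddChar (Q x)) =
      ∑ d, ZMod.stdAddChar (Q d) * ∑ x, ZMod.stdAddChar (B d x) := by
    rw [map_sum, sum_mul_sum, sum_comm]
    calc ∑ x, ∑ y, ZMod.stdAddChar (Q y) * (starRingEnd ℂ) (ZMod.stdAddChar (Q x))
        = ∑ x, ∑ d, ZMod.stdAddChar (Q (x + d)) * (starRingEnd ℂ) (ZMod.stdAddChar (Q x)) := by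
          refine sum_congr rfl fun x _ => ?_
          exact (Equiv.sum_comp (Equiv.addLeft x) (fun y => ZMod.stdAddChar (Q y) *
            (starRingEnd ℂ) (ZMod.stdAddChar (Q x)))).symm
      _ = ∑ x, ∑ d, ZMod.stdAddChar (Q d) * ZMod.stdAddChar (B d x) := by
          refine sum_congr rfl fun x _ => sum_congr rfl fun d _ => ?_
          rw [hQ, AddChar.map_add_eq_mul, AddChar.map_add_eq_mul]
          have : ZMod.stdAddChar (Q x) * (starRingEnd ℂ) (ZMod.stdAddChar (Q x)) = 1 := by
            rw [Complex.mul_conj, Complex.normSq_eq_norm_sq, norm_stdAddChar]; simp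
          linear_combination ZMod.stdAddChar (Q d) * ZMod.stdAddChar (B d x) * this
      _ = _ := by
          rw [sum_comm]
          exact sum_congr rfl fun d _ => (mul_sum _ _ _).symm
  have h2 : ∀ d, ‖∑ x, ZMod.stdAddChar (B d x)‖ =
      if ∀ x, B d x = 0 then (Fintype.card M : ℝ) else 0 := by
    intro d
    have h := AddChar.sum_eq_ite ((ZMod.stdAddChar (N := a)).compAddMonoidHom (B d))
    have h' : ∑ x, ZMod.stdAddChar (B d x) =
      if ∀ x, B d x = 0 then (Fintype.card M : ℂ) else 0 := by
      refine Eq.trans h (if_congr ?_ rfl rfl)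
      constructor
      · intro h0 x
        have := DFunLike.congr_fun h0 x
        exact ZMod.injective_stdAddChar (this.trans (AddChar.map_zero_eq_one _).symm)
      · intro h0
        ext x
        simp [h0]
    rw [h']
    split_ifs <;> simp
  have h3 : ‖∑ x, ZMod.stdAddChar (Q x)‖ ^ 2 =
      ‖∑ d, ZMod.stdAddChar (Q d) * ∑ x, ZMod.stdAddChar (B d x)‖ := by
    rw [← h1, norm_mul, RCLike.norm_conj, sq]
  rw [h3]
  refine (norm_sum_le _ _).trans ?_
  simp only [norm_mul, norm_stdAddChar, one_mul, h2]
  rw [← sum_filter, sum_const, nsmul_eq_mul, mul_comm, Nat.card_eq_fintype_card,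
    Fintype.card_subtype]

end CharSum

/-! ### The Gauss sum of an alternating form -/

section Gauss

open Finset

theorem sum_pairs_eq {M : Type*} [AddCommMonoid M] {n : ℕ} (F : Fin n → Fin n → M) :
    ∑ i, ∑ j, F i j = ∑ i, F i i +
      ∑ p : Fin n × Fin n with p.1 < p.2, (F p.1 p.2 + F p.2 p.1) := by
  have h1 : ∑ p : Fin n × Fin n with p.2 < p.1, F p.1 p.2 =
      ∑ p : Fin n × Fin n with p.1 < p.2, F p.2 p.1 :=
    sum_bij' (fun p _ => p.swap) (fun p _ => p.swap) (by simp) (by simp) (by simp) (by simp)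
      (by simp)
  have h2 : ∑ p : Fin n × Fin n with p.1 = p.2, F p.1 p.2 = ∑ i, F i i :=
    sum_bij' (fun p _ => p.1) (fun i _ => (i, i)) (by simp) (by simp)
      (by rintro ⟨i, j⟩ h; simp_all) (by simp) (by rintro ⟨i, j⟩ h; simp_all)
  rw [sum_add_distrib, ← h1, ← h2, ← Fintype.sum_prod_type',
    ← sum_filter_add_sum_filter_not univ (fun p : Fin n × Fin n => p.1 = p.2)]
  congr 1
  rw [← sum_filter_add_sum_filter_not _ (fun p : Fin n × Fin n => p.1 < p.2), filter_filter,
    filter_filter]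
  congr 1
  · refine sum_congr (filter_congr fun p _ => ?_) fun _ _ => rfl
    exact ⟨fun h => h.2, fun h => ⟨h.ne, h⟩⟩
  · refine sum_congr (filter_congr fun p _ => ?_) fun _ _ => rfl
    exact ⟨fun h => lt_of_le_of_ne (not_lt.1 h.2) (Ne.symm h.1), fun h => ⟨ne_of_gt h, h.not_gt⟩⟩

/-- Modulo the image of `C`, the multiples of `h` are generated by `h` times `g` vectors. -/
def GeneratesMultiples {R : Type*} [CommRing R] {n : ℕ} (C : Matrix (Fin n) (Fin n) R) (h : R)
    (g : ℕ) : Prop :=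
  ∃ v : Fin g → Fin n → R, ∀ u : Fin n → R, ∃ (c : Fin g → R) (z : Fin n → R),
    ∀ i, h * u i = h * ∑ k, c k * v k i + ∑ j, C i j * z j

variable {a : ℕ} [NeZero a] {G : Type*} [AddCommGroup G] [Module (ZMod a) G] [Finite G] {n : ℕ}

/-- If $\theta=h\psi$ has $\theta(x,y)\ne0$, then $0,\theta x,\theta y,\theta(x+y)$ are told apart
by evaluation at $x$ and $y$, because $\theta$ is alternating. The square root of this 4 is the base
2 of the final error. -/
theorem four_le_card_range (ψ : AltForm a G) (h : ZMod a) (hψ : ¬ ∀ x y, h * ψ.1 x y = 0) :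
    4 ≤ Nat.card (LinearMap.range (h • ψ.1)) := by
  push Not at hψ
  obtain ⟨x, y, hxy⟩ := hψ
  have hyx : h * ψ.1 y x ≠ 0 := by
    rw [ψ.neg]; simpa using hxy
  set θ := h • ψ.1 with hθ
  have e : ∀ x y, θ x y = h * ψ.1 x y := fun _ _ => rfl
  have e0 : ∀ x, θ x x = 0 := fun x => by rw [e, ψ.2, mul_zero]
  rw [← e] at hxy hyx
  let F : Bool × Bool → LinearMap.range θ := fun p =>
    ⟨θ ((if p.1 then x else 0) + (if p.2 then y else 0)), LinearMap.mem_range_self _ _⟩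
  have hF : Function.Injective F := by
    rintro ⟨i, j⟩ ⟨i', j'⟩ hp
    have h0 := congrArg Subtype.val hp
    have hx := DFunLike.congr_fun h0 x
    have hy := DFunLike.congr_fun h0 y
    simp only [F, map_add, LinearMap.add_apply] at hx hy
    cases i <;> cases j <;> cases i' <;> cases j' <;> simp_all
  have := Nat.card_le_card_of_injective F hF
  simpa using this

/-- With $\theta=h\psi$ of image $I$, writing each $h e_j$ as $h$ times a combination of the `g`
generators plus an element of $C R^n$ shows that all $\theta(d_j)$ are determined by `g` elements of
$I$. The remaining freedom in $d$ is $(\ker\theta)^n$, of order $(|G|/|I|)^n$. -/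
theorem card_annihilated_mul_le (C : Matrix (Fin n) (Fin n) (ZMod a)) (h : ZMod a) {g : ℕ}
    (hg : GeneratesMultiples C h g) (ψ : G →ₗ[ZMod a] Module.Dual (ZMod a) G) :
    Nat.card {d : Fin n → G // ∀ j, ∑ i, C i j • ψ (d i) = 0} *
      Nat.card (LinearMap.range (h • ψ)) ^ n ≤
    Nat.card G ^ n * Nat.card (LinearMap.range (h • ψ)) ^ g := by
  obtain ⟨v, hv⟩ := hg
  set θ := h • ψ with hθ
  have hs : ∀ y : LinearMap.range θ, ∃ x, θ x = y := fun y => y.2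
  choose σ hσ using hs
  let Y (d : Fin n → G) (k : Fin g) : LinearMap.range θ := ⟨θ (∑ i, v k i • d i), ⟨_, rfl⟩⟩
  let T (x : G) : LinearMap.range θ := ⟨θ x, x, rfl⟩
  have hY : ∀ d d' : {d : Fin n → G // ∀ j, ∑ i, C i j • ψ (d i) = 0}, Y d = Y d' →
      ∀ j, θ (d.1 j) = θ (d'.1 j) := by
    intro d d' hdd j
    obtain ⟨c, z, hcz⟩ := hv (Pi.single j 1)
    have key : ∀ d : {d : Fin n → G // ∀ j, ∑ i, C i j • ψ (d i) = 0},
        θ (d.1 j) = ∑ k, c k • (Y d k : Module.Dual (ZMod a) G) := by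
      intro d
      calc θ (d.1 j) = ∑ i, (h * (Pi.single j 1 : Fin n → ZMod a) i) • ψ (d.1 i) := by
            simp [Pi.single_apply, hθ]
        _ = ∑ i, (h * ∑ k, c k * v k i) • ψ (d.1 i) + ∑ i, (∑ l, C i l * z l) • ψ (d.1 i) := by
            rw [← sum_add_distrib]
            exact sum_congr rfl fun i _ => by rw [hcz, add_smul]
        _ = ∑ k, c k • (Y d k : Module.Dual (ZMod a) G) + ∑ l, z l • ∑ i, C i l • ψ (d.1 i) := by
            congr 1
            · simp only [Y, hθ, map_sum, map_smul, LinearMap.smul_apply, smul_sum, sum_smul,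
                mul_sum, smul_smul]
              rw [sum_comm]
              exact sum_congr rfl fun k _ => sum_congr rfl fun i _ => by congr 1; ring
            · simp only [smul_sum, sum_smul, smul_smul]
              rw [sum_comm]
              exact sum_congr rfl fun k _ => sum_congr rfl fun i _ => by congr 1; ring
        _ = _ := by simp [d.2]
    rw [key, key, hdd]
  -- Using the section `σ` of `θ`, replace the class of each $d_j$ modulo $\ker\theta$ by that of
  -- $y_j$. Nothing is lost, since `Y d` remembers the original classes.
  let F : {d : Fin n → G // ∀ j, ∑ i, C i j • ψ (d i) = 0} × (Fin n → LinearMap.range θ) →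
      (Fin n → G) × (Fin g → LinearMap.range θ) := fun p =>
    (fun j => p.1.1 j - σ (T (p.1.1 j)) + σ (p.2 j), Y p.1)
  have hF : Function.Injective F := by
    rintro ⟨d, y⟩ ⟨d', y'⟩ hp
    have h1 : ∀ j, d.1 j - σ (T (d.1 j)) + σ (y j) = d'.1 j - σ (T (d'.1 j)) + σ (y' j) :=
      fun j => congrFun (congrArg Prod.fst hp) j
    have h2 := hY d d' (congrArg Prod.snd hp)
    have hy : y = y' := by
      ext1 j
      have := congrArg θ (h1 j)
      rw [map_add, map_add, map_sub, map_sub, hσ, hσ, hσ, hσ] at this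
      apply Subtype.ext
      simpa [T] using this
    subst hy
    refine Prod.ext (Subtype.ext (funext fun j => ?_)) rfl
    have hT : T (d.1 j) = T (d'.1 j) := Subtype.ext (h2 j)
    have := h1 j
    rw [hT] at this
    simpa using this
  have := Nat.card_le_card_of_injective F hF
  simpa [Nat.card_prod, Nat.card_fun] using this

/-- The exponent of the phase attached to an alternating form and a tuple. -/
def phase (C : Matrix (Fin n) (Fin n) (ZMod a)) (ψ : G →ₗ[ZMod a] Module.Dual (ZMod a) G)
    (f : Fin n → G) : ZMod a :=
  -∑ p : Fin n × Fin n with p.1 < p.2, C p.1 p.2 * ψ (f p.1) (f p.2)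

/-- The phase is quadratic in `f` with polar form $-\sum_{i,j}C_{ij}\psi(d_i,x_j)$, as both `C` and
`ψ` are skew. Its radical has order at most $|G|^n4^{g-n}$ when $g\le n$; for $n\le g$ the trivial
bound suffices. -/
theorem norm_sum_phase_le [Fintype G] (C : Matrix (Fin n) (Fin n) (ZMod a))
    (hC : IsAlternating C) (h : ZMod a) {g : ℕ} (hg : GeneratesMultiples C h g) (ψ : AltForm a G)
    (hψ : ¬ ∀ x y, h * ψ.1 x y = 0) :
    ‖∑ f : Fin n → G, ZMod.stdAddChar (phase C ψ.1 f)‖ ≤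
      (Fintype.card G : ℝ) ^ n * 2 ^ ((g : ℤ) - (n : ℤ)) := by
  classical
  have hG : (0 : ℝ) < Fintype.card G := by exact_mod_cast Fintype.card_pos
  rcases le_total n g with hng | hng
  · calc ‖∑ f : Fin n → G, ZMod.stdAddChar (phase C ψ.1 f)‖
        ≤ ∑ f : Fin n → G, ‖ZMod.stdAddChar (phase C ψ.1 f)‖ := norm_sum_le _ _
      _ = (Fintype.card G : ℝ) ^ n * 1 := by simp
      _ ≤ _ := by
          gcongr
          exact one_le_zpow₀ one_le_two (by omega)
  let B : (Fin n → G) →+ (Fin n → G) →+ ZMod a :=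
    AddMonoidHom.mk' (fun d => AddMonoidHom.mk' (fun x => -∑ i, ∑ j, C i j * ψ.1 (d i) (x j))
      fun x y => by
        simp only [Pi.add_apply, map_add, mul_add, sum_add_distrib, neg_add]) fun d d' => by
      refine DFunLike.ext _ _ fun x => ?_
      simp only [Pi.add_apply, map_add, mul_add, sum_add_distrib, neg_add, LinearMap.add_apply,
        AddMonoidHom.mk'_apply, AddMonoidHom.add_apply]
  have hBapp : ∀ d x, B d x = -∑ i, ∑ j, C i j * ψ.1 (d i) (x j) := fun _ _ => rfl
  have hskew : ∀ i j, C j i = -C i j := fun i j => by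
    have := congrFun (congrFun hC.1 i) j
    simpa using this
  have hQ : ∀ x d, phase C ψ.1 (x + d) = phase C ψ.1 x + phase C ψ.1 d + B d x := by
    intro x d
    rw [hBapp, sum_pairs_eq]
    simp only [hC.2, zero_mul, sum_const_zero, zero_add, phase]
    rw [← neg_add, ← neg_add, ← sum_add_distrib, ← sum_add_distrib]
    congr 1
    refine sum_congr rfl fun p _ => ?_
    rw [hskew p.1 p.2, ψ.neg (d p.2) (x p.1)]
    simp only [Pi.add_apply, map_add, LinearMap.add_apply]
    ring
  have h1 := norm_sum_quadratic_le (phase C ψ.1) B hQ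
  have h2 : Nat.card {d // ∀ x, B d x = 0} ≤
      Nat.card {d : Fin n → G // ∀ j, ∑ i, C i j • ψ.1 (d i) = 0} := by
    refine Nat.card_le_card_of_injective (fun d => ⟨d.1, fun j => ?_⟩) fun d d' hd =>
      Subtype.ext (congrArg (fun z => z.1) hd)
    ext y
    have := d.2 (Pi.single j y)
    rw [hBapp, neg_eq_zero, sum_comm] at this
    rw [sum_eq_single j (fun i _ hij => by simp [Pi.single_eq_of_ne hij]) (by simp)] at this
    simpa using this
  have h3 := card_annihilated_mul_le C h hg ψ.1
  have h4 := four_le_card_range ψ h hψ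
  set I := Nat.card (LinearMap.range (h • ψ.1))
  set U := Nat.card {d : Fin n → G // ∀ j, ∑ i, C i j • ψ.1 (d i) = 0}
  rw [Nat.card_eq_fintype_card] at h3
  obtain ⟨k, rfl⟩ := Nat.exists_eq_add_of_le hng
  have h5 : U * 4 ^ k ≤ Fintype.card G ^ (g + k) := by
    have hI : 0 < I ^ g := by positivity
    rw [pow_add I, ← mul_assoc, mul_right_comm] at h3
    exact (Nat.mul_le_mul_left _ (Nat.pow_le_pow_left h4 k)).trans (Nat.le_of_mul_le_mul_right h3 hI)
  have h6 : (U : ℝ) * 4 ^ k ≤ (Fintype.card G : ℝ) ^ (g + k) := by exact_mod_cast h5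
  have hexp : ((g : ℤ) - ((g + k : ℕ) : ℤ)) = -(k : ℤ) := by push_cast; ring
  rw [hexp, zpow_neg, zpow_natCast, ← div_eq_mul_inv]
  refine le_of_sq_le_sq ?_ (by positivity)
  refine h1.trans ?_
  have h7 : ((2 : ℝ) ^ k) ^ 2 = 4 ^ k := by
    rw [← pow_mul, mul_comm, pow_mul]; norm_num
  rw [div_pow, h7, le_div_iff₀ (by positivity), Fintype.card_fun, Fintype.card_fin, Nat.cast_pow,
    mul_assoc, sq]
  gcongr
  refine le_trans ?_ h6
  gcongr

end Gauss

/-! ### Tuples of weight zero and the main term -/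

section MainTerm

open Finset

variable {a : ℕ} [NeZero a] {G : Type*} [AddCommGroup G] [Module (ZMod a) G] {n : ℕ}

/-- The tuple `f` generates `G`. -/
def IsGenerating (a : ℕ) {G : Type*} [AddCommGroup G] [Module (ZMod a) G] {n : ℕ}
    (f : Fin n → G) : Prop :=
  Submodule.span (ZMod a) (Set.range f) = ⊤

theorem IsGenerating.surjective {f : Fin n → G} (hf : IsGenerating a f) :
    Function.Surjective (Fintype.linearCombination (ZMod a) f) := by
  rw [← LinearMap.range_eq_top, Fintype.range_linearCombination]
  exact hf

theorem weight_eq_zero_iff (f : Fin n → G) (φ : Fin n → Module.Dual (ZMod a) G) :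
    weight hypQuad hypBilin (fun i => (f i, φ i)) = 0 ↔
      (∀ i, φ i (f i) = 0) ∧ ∀ i j, i < j → φ i (f j) + φ j (f i) = 0 := by
  rw [weight_eq_zero]
  rfl

theorem weight_eq_zero_of_altForm (ψ : AltForm a G) (f : Fin n → G) :
    weight hypQuad hypBilin (fun i => (f i, ψ.1 (f i))) = 0 := by
  rw [weight_eq_zero_iff]
  refine ⟨fun i => ψ.2 _, fun i j _ => ?_⟩
  rw [ψ.neg, neg_add_cancel]

/-- Extend `f` and `φ` linearly to $F$ and $\Phi$ on $R^n$. Weight zero says $\Phi(v)(F v)=0$, so by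
polarization $\Phi(v)(Fw)=-\Phi(w)(Fv)$; since $F$ is onto, $\ker F\subseteq\ker\Phi$ and $\Phi$
descends to $G$. -/
theorem exists_altForm {f : Fin n → G} (hf : IsGenerating a f) {φ : Fin n → Module.Dual (ZMod a) G}
    (hφ : weight hypQuad hypBilin (fun i => (f i, φ i)) = 0) :
    ∃ ψ : AltForm a G, ∀ i, ψ.1 (f i) = φ i := by
  rw [weight_eq_zero_iff] at hφ
  set F := Fintype.linearCombination (ZMod a) f
  set Φ := Fintype.linearCombination (ZMod a) φ
  have hF : ∀ v, F v = ∑ i, v i • f i := fun v => Fintype.linearCombination_apply _ _ _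
  have hΦ : ∀ v, Φ v = ∑ i, v i • φ i := fun v => Fintype.linearCombination_apply _ _ _
  have halt : ∀ v, Φ v (F v) = 0 := by
    intro v
    rw [hF, hΦ]
    simp only [LinearMap.sum_apply, map_sum, map_smul, LinearMap.smul_apply, smul_eq_mul,
      mul_sum]
    rw [sum_pairs_eq]
    simp only [hφ.1, mul_zero, sum_const_zero, zero_add]
    refine sum_eq_zero fun p hp => ?_
    have h1 := hφ.2 p.1 p.2 (mem_filter.1 hp).2
    linear_combination v p.1 * v p.2 * h1
  have hskew : ∀ v w, Φ v (F w) + Φ w (F v) = 0 := by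
    intro v w
    have := halt (v + w)
    simp only [map_add, LinearMap.add_apply, halt, zero_add, add_zero] at this
    rwa [add_comm]
  have hker : ∀ v v', F v = F v' → Φ v = Φ v' := by
    intro v v' h
    rw [← sub_eq_zero, ← map_sub]
    ext x
    obtain ⟨w, rfl⟩ := hf.surjective x
    have := hskew (v - v') w
    rwa [map_sub F, h, sub_self, map_zero, add_zero] at this
  let s := Function.surjInv hf.surjective
  have hs : ∀ x, F (s x) = x := Function.surjInv_eq hf.surjective
  refine ⟨⟨AddMonoidHom.toZModLinearMap a (AddMonoidHom.mk' (fun x => Φ (s x)) fun x y => ?_),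
    fun x => ?_⟩, fun i => ?_⟩
  · rw [← map_add]
    exact hker _ _ (by rw [map_add, hs, hs, hs])
  · have := halt (s x)
    rwa [hs] at this
  · change Φ (s (f i)) = φ i
    have : Φ (Pi.single i 1) = φ i := by simp [Φ]
    rw [← this]
    exact hker _ _ (by rw [hs]; simp [F])

theorem altForm_eq_of_generating {f : Fin n → G} (hf : IsGenerating a f) {ψ ψ' : AltForm a G}
    (h : ∀ i, ψ.1 (f i) = ψ'.1 (f i)) : ψ = ψ' := by
  refine Subtype.ext (LinearMap.ext_on_range (v := f) hf h)

variable [Fintype G] [Fintype (Module.Dual (ZMod a) G)] [Fintype (AltForm a G)]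

open scoped Classical in
theorem sum_weight_zero_eq {f : Fin n → G} (hf : IsGenerating a f)
    (T : (Fin n → Module.Dual (ZMod a) G) → ℂ) :
    ∑ φ : Fin n → Module.Dual (ZMod a) G with
      weight hypQuad hypBilin (fun i => (f i, φ i)) = 0, T φ =
    ∑ ψ : AltForm a G, T fun i => ψ.1 (f i) := by
  symm
  refine sum_bij (fun ψ _ i => ψ.1 (f i)) (fun ψ _ => ?_) (fun ψ _ ψ' _ h => ?_) (fun φ hφ => ?_)
    fun _ _ => rfl
  · simpa using weight_eq_zero_of_altForm ψ f
  · exact altForm_eq_of_generating hf fun i => congrFun h i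
  · obtain ⟨ψ, hψ⟩ := exists_altForm hf (mem_filter.1 hφ).2
    exact ⟨ψ, mem_univ _, funext hψ⟩

open scoped Classical in
-- A tuple that does not generate lies in some proper submodule, which has index at least 2; take
-- the union bound over submodules.
theorem card_not_generating_le :
    (#{f : Fin n → G | ¬ IsGenerating a f} : ℝ) * 2 ^ n ≤
      Nat.card (Submodule (ZMod a) G) * (Fintype.card G : ℝ) ^ n := by
  have : Fintype (Submodule (ZMod a) G) := Fintype.ofFinite _
  have hsub : ({f : Fin n → G | ¬ IsGenerating a f} : Finset _) ⊆
      ({H : Submodule (ZMod a) G | H ≠ ⊤} : Finset _).biUnion fun H =>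
        Fintype.piFinset fun _ : Fin n => ({x | x ∈ H} : Finset G) := by
    intro f hf
    simp only [mem_filter, mem_univ, true_and, mem_biUnion, Fintype.mem_piFinset] at hf ⊢
    exact ⟨_, hf, fun i => Submodule.subset_span ⟨i, rfl⟩⟩
  have hH : ∀ H : Submodule (ZMod a) G, H ≠ ⊤ → 2 * #{x | x ∈ H} ≤ Fintype.card G := by
    intro H hH
    have h1 : #{x | x ∈ H} = Nat.card H := by
      rw [Nat.card_eq_fintype_card, Fintype.card_subtype]
    obtain ⟨k, hk⟩ := H.toAddSubgroup.card_addSubgroup_dvd_card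
    rw [h1, ← Nat.card_eq_fintype_card]
    change Nat.card G = Nat.card H * k at hk
    have hpos : 0 < Nat.card G := Nat.card_pos
    have hk2 : 2 ≤ k := by
      rcases k with _ | _ | k
      · omega
      · exfalso
        apply hH
        have := AddSubgroup.eq_top_of_card_eq H.toAddSubgroup (by
          change Nat.card H = _; omega)
        exact Submodule.toAddSubgroup_injective (by rw [this]; rfl)
      · omega
    rw [hk, mul_comm]
    exact Nat.mul_le_mul_left _ hk2
  have h2 : #{f : Fin n → G | ¬ IsGenerating a f} * 2 ^ n ≤
      Nat.card (Submodule (ZMod a) G) * Fintype.card G ^ n := by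
    calc #{f : Fin n → G | ¬ IsGenerating a f} * 2 ^ n
        ≤ (∑ H ∈ ({H : Submodule (ZMod a) G | H ≠ ⊤} : Finset _),
            #(Fintype.piFinset fun _ : Fin n => ({x | x ∈ H} : Finset G))) * 2 ^ n :=
          Nat.mul_le_mul_right _ ((card_le_card hsub).trans card_biUnion_le)
      _ = ∑ H ∈ ({H : Submodule (ZMod a) G | H ≠ ⊤} : Finset _), (2 * #{x | x ∈ H}) ^ n := by
          rw [sum_mul]
          refine sum_congr rfl fun H _ => ?_
          rw [Fintype.card_piFinset_const, mul_pow, mul_comm]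
      _ ≤ ∑ H ∈ ({H : Submodule (ZMod a) G | H ≠ ⊤} : Finset _), Fintype.card G ^ n :=
          sum_le_sum fun H h => Nat.pow_le_pow_left (hH H (mem_filter.1 h).2) n
      _ ≤ ∑ H : Submodule (ZMod a) G, Fintype.card G ^ n :=
          sum_le_sum_of_subset (subset_univ _)
      _ = _ := by rw [sum_const, card_univ, smul_eq_mul, Nat.card_eq_fintype_card]
  exact_mod_cast h2

open scoped Classical in
/-- The tuples of weight zero contribute the number of alternating forms killed by `h`. -/
theorem norm_mainTerm_sub_le (C : Matrix (Fin n) (Fin n) (ZMod a)) (hC : IsAlternating C)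
    (h : ℤ) (hdvd : ∀ i j, (h : ZMod a) ∣ C i j) {g : ℕ}
    (hg : GeneratesMultiples C (h : ZMod a) g) :
    ‖∑ f : Fin n → G with IsGenerating a f,
        ∑ φ : Fin n → Module.Dual (ZMod a) G with
          weight hypQuad hypBilin (fun i => (f i, φ i)) = 0,
        ZMod.stdAddChar (-∑ p : Fin n × Fin n with p.1 < p.2, C p.1 p.2 * φ p.1 (f p.2)) -
      (Fintype.card G : ℂ) ^ n * wedgeCard G h‖ ≤
    (Fintype.card G : ℝ) ^ n * (Fintype.card (AltForm a G) *
      (1 + Nat.card (Submodule (ZMod a) G)) * 2 ^ ((g : ℤ) - (n : ℤ))) := by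
  have hG : (0 : ℝ) < Fintype.card G := by exact_mod_cast Fintype.card_pos
  have h1 : ∑ f : Fin n → G with IsGenerating a f,
        ∑ φ : Fin n → Module.Dual (ZMod a) G with
          weight hypQuad hypBilin (fun i => (f i, φ i)) = 0,
        ZMod.stdAddChar (-∑ p : Fin n × Fin n with p.1 < p.2, C p.1 p.2 * φ p.1 (f p.2)) =
      ∑ ψ : AltForm a G, ∑ f : Fin n → G with IsGenerating a f,
        ZMod.stdAddChar (phase C ψ.1 f) := by
    rw [sum_comm]
    refine sum_congr rfl fun f hf => ?_
    rw [sum_weight_zero_eq (mem_filter.1 hf).2 fun φ => ZMod.stdAddChar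
      (-∑ p : Fin n × Fin n with p.1 < p.2, C p.1 p.2 * φ p.1 (f p.2))]
    rfl
  have h2 : (Fintype.card G : ℂ) ^ n * wedgeCard G h = ∑ ψ : AltForm a G,
      if ∀ x y, (h : ZMod a) * ψ.1 x y = 0 then (Fintype.card G : ℂ) ^ n else 0 := by
    rw [← sum_filter, sum_const, nsmul_eq_mul, mul_comm, wedgeCard_eq (a := a),
      Nat.card_eq_fintype_card, Fintype.card_subtype]
  have hz : (2 : ℝ) ^ ((g : ℤ) - (n : ℤ)) = 2 ^ g / 2 ^ n := by
    rw [zpow_sub₀ two_ne_zero, zpow_natCast, zpow_natCast]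
  have hng : (#{f : Fin n → G | ¬ IsGenerating a f} : ℝ) ≤
      (Fintype.card G : ℝ) ^ n * (Nat.card (Submodule (ZMod a) G) * 2 ^ ((g : ℤ) - (n : ℤ))) := by
    rw [hz, ← mul_div_assoc, ← mul_div_assoc, le_div_iff₀ (by positivity)]
    refine card_not_generating_le.trans ?_
    have : (1 : ℝ) ≤ 2 ^ g := one_le_pow₀ one_le_two
    have h0 : 0 ≤ (Nat.card (Submodule (ZMod a) G) : ℝ) * (Fintype.card G : ℝ) ^ n := by positivity
    nlinarith
  rw [h1, h2, ← sum_sub_distrib]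
  refine (norm_sum_le _ _).trans ?_
  have hterm : ∀ ψ : AltForm a G, ‖∑ f : Fin n → G with IsGenerating a f,
      ZMod.stdAddChar (phase C ψ.1 f) -
      (if ∀ x y, (h : ZMod a) * ψ.1 x y = 0 then (Fintype.card G : ℂ) ^ n else 0)‖ ≤
      (Fintype.card G : ℝ) ^ n * ((1 + Nat.card (Submodule (ZMod a) G)) *
        2 ^ ((g : ℤ) - (n : ℤ))) := by
    intro ψ
    -- The Gauss sum estimate needs all tuples, so the sum is completed; the tuples added number
    -- only $O(|G|^n2^{-n})$, and $2^{-n}\le2^{g-n}$.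
    have hsplit := sum_filter_add_sum_filter_not univ (fun f : Fin n → G => IsGenerating a f)
      (fun f => ZMod.stdAddChar (phase C ψ.1 f))
    have hnot : ‖∑ f : Fin n → G with ¬ IsGenerating a f, ZMod.stdAddChar (phase C ψ.1 f)‖ ≤
        #{f : Fin n → G | ¬ IsGenerating a f} := by
      refine (norm_sum_le _ _).trans ?_
      simp
    have hall : ‖∑ f : Fin n → G, ZMod.stdAddChar (phase C ψ.1 f) -
        (if ∀ x y, (h : ZMod a) * ψ.1 x y = 0 then (Fintype.card G : ℂ) ^ n else 0)‖ ≤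
        (Fintype.card G : ℝ) ^ n * 2 ^ ((g : ℤ) - (n : ℤ)) := by
      split_ifs with hψ
      · have : ∀ f : Fin n → G, phase C ψ.1 f = 0 := by
          intro f
          rw [phase, neg_eq_zero]
          refine sum_eq_zero fun p _ => ?_
          obtain ⟨k, hk⟩ := hdvd p.1 p.2
          rw [hk, mul_right_comm, hψ, zero_mul]
        simp only [this, AddChar.map_zero_eq_one, sum_const, card_univ, Fintype.card_fun,
          Fintype.card_fin, nsmul_eq_mul, mul_one, Nat.cast_pow, sub_self, norm_zero]
        positivity
      · rw [sub_zero]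
        exact norm_sum_phase_le C hC _ hg ψ hψ
    calc _ = ‖(∑ f : Fin n → G, ZMod.stdAddChar (phase C ψ.1 f) -
        (if ∀ x y, (h : ZMod a) * ψ.1 x y = 0 then (Fintype.card G : ℂ) ^ n else 0)) -
        ∑ f : Fin n → G with ¬ IsGenerating a f, ZMod.stdAddChar (phase C ψ.1 f)‖ := by
          rw [← hsplit]; congr 1; ring
      _ ≤ _ := norm_sub_le _ _
      _ ≤ _ := add_le_add hall (hnot.trans hng)
      _ = _ := by ring
  refine (sum_le_sum fun ψ _ => hterm ψ).trans (le_of_eq ?_)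
  rw [sum_const, card_univ, nsmul_eq_mul]
  ring

end MainTerm

/-! ### Balanced random variables have small characters -/

section Balanced

open Finset

variable {a : ℕ} [NeZero a]

theorem exists_re_stdAddChar_le (a : ℕ) [NeZero a] :
    ∃ η : ℝ, 0 < η ∧ ∀ s : ZMod a, s ≠ 0 → (ZMod.stdAddChar s).re ≤ 1 - η := by
  classical
  have hlt : ∀ s : ZMod a, s ≠ 0 → (ZMod.stdAddChar s).re < 1 := by
    intro s hs
    refine lt_of_le_of_ne ((Complex.re_le_norm _).trans (norm_stdAddChar s).le) fun h => hs ?_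
    apply ZMod.injective_stdAddChar
    rw [AddChar.map_zero_eq_one]
    have h1 : Complex.normSq (ZMod.stdAddChar s) = 1 := by
      rw [Complex.normSq_eq_norm_sq, norm_stdAddChar, one_pow]
    rw [Complex.normSq_apply, h] at h1
    have h2 : (ZMod.stdAddChar s).im = 0 := by nlinarith
    exact Complex.ext h h2
  rcases (({s : ZMod a | s ≠ 0} : Finset (ZMod a))).eq_empty_or_nonempty with h0 | hne
  · refine ⟨1, one_pos, fun s hs => ?_⟩
    have : s ∈ ({s : ZMod a | s ≠ 0} : Finset (ZMod a)) := by simpa using hs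
    rw [h0] at this
    simp at this
  · obtain ⟨s₀, hs₀, hmax⟩ := exists_max_image _ (fun s => (ZMod.stdAddChar (N := a) s).re) hne
    refine ⟨1 - (ZMod.stdAddChar s₀).re, by linarith [hlt s₀ (mem_filter.1 hs₀).2], fun s hs => ?_⟩
    have := hmax s (by simpa using hs)
    linarith

/-- For independent copies $s,t$ the square is $\mathbb E\,\mathrm{Re}\,\chi(s-t)\le1-\eta\,\mathbb
P[s\ne t]$, and the collision probability $\sum p_s^2$ is at most $\max p_s\le1-\varepsilon$. -/
theorem norm_sum_mul_stdAddChar_sq_le {η ε : ℝ} (hη : 0 ≤ η)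
    (hre : ∀ s : ZMod a, s ≠ 0 → (ZMod.stdAddChar s).re ≤ 1 - η) {p : ZMod a → ℝ}
    (hp : ∀ s, 0 ≤ p s) (hsum : ∑ s, p s = 1) (hle : ∀ s, p s ≤ 1 - ε) :
    ‖∑ s, (p s : ℂ) * ZMod.stdAddChar s‖ ^ 2 ≤ 1 - η * ε := by
  have h1 : ‖∑ s, (p s : ℂ) * ZMod.stdAddChar s‖ ^ 2 =
      ∑ s, ∑ t, p s * p t * (ZMod.stdAddChar (s - t)).re := by
    rw [← Complex.normSq_eq_norm_sq]
    have : ((Complex.normSq (∑ s, (p s : ℂ) * ZMod.stdAddChar s) : ℝ) : ℂ) =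
        ∑ s, ∑ t, ((p s * p t : ℝ) : ℂ) * ZMod.stdAddChar (s - t) := by
      rw [← Complex.mul_conj, map_sum, sum_mul_sum]
      refine sum_congr rfl fun s _ => sum_congr rfl fun t _ => ?_
      rw [map_mul, Complex.conj_ofReal, sub_eq_add_neg, AddChar.map_add_eq_mul,
        AddChar.map_neg_eq_conj]
      push_cast
      ring
    have h2 := congrArg Complex.re this
    rw [Complex.ofReal_re] at h2
    rw [h2]
    simp only [Complex.re_sum, Complex.re_ofReal_mul]
  have h2 : ∀ s t, p s * p t * (ZMod.stdAddChar (s - t)).re ≤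
      (1 - η) * (p s * p t) + if s = t then η * (p s * p t) else 0 := by
    intro s t
    have hpp := mul_nonneg (hp s) (hp t)
    split_ifs with hst
    · rw [hst, sub_self, AddChar.map_zero_eq_one, Complex.one_re]
      linarith
    · have := mul_le_mul_of_nonneg_left (hre (s - t) (sub_ne_zero.2 hst)) hpp
      linarith
  rw [h1]
  refine (sum_le_sum fun s _ => sum_le_sum fun t _ => h2 s t).trans ?_
  simp only [sum_add_distrib, ← mul_sum, sum_ite_eq, mem_univ, if_true, hsum, mul_one]
  have h3 : ∑ s, p s * p s ≤ 1 - ε := by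
    calc ∑ s, p s * p s ≤ ∑ s, p s * (1 - ε) :=
          sum_le_sum fun s _ => mul_le_mul_of_nonneg_left (hle s) (hp s)
      _ = 1 - ε := by rw [← sum_mul, hsum, one_mul]
  nlinarith

/-- No nonzero multiple of a balanced variable is concentrated at a point. -/
theorem IsBalanced.measureReal_mul_eq_le {R : Type*} [CommRing R] {Ω : Type*} [MeasurableSpace Ω]
    {P : Measure Ω} [IsProbabilityMeasure P] {ε : ℝ} {N : Ω → R} (hN : IsBalanced P ε N) {m : R}
    (hm : m ≠ 0) (s : R) : P.real {ω | m * N ω = s} ≤ 1 - ε := by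
  have hne : Ideal.torsionOf R R m ≠ ⊤ := by
    rw [Ne, Ideal.eq_top_iff_one, Ideal.mem_torsionOf_iff, one_smul]
    exact hm
  -- Two solutions of $mN=s$ differ by an element of the annihilator of `m`, so they agree modulo
  -- any maximal ideal containing it.
  obtain ⟨𝔭, h𝔭, hle⟩ := Ideal.exists_le_maximal _ hne
  have h0 := hN 𝔭 h𝔭 0
  rcases Set.eq_empty_or_nonempty {ω | m * N ω = s} with h | ⟨ω₀, hω₀⟩
  · rw [h, measureReal_empty]
    exact measureReal_nonneg.trans h0
  · refine (measureReal_mono ?_).trans (hN 𝔭 h𝔭 (Ideal.Quotient.mk 𝔭 (N ω₀)))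
    intro ω hω
    change m * N ω = s at hω
    change m * N ω₀ = s at hω₀
    change Ideal.Quotient.mk 𝔭 (N ω) = Ideal.Quotient.mk 𝔭 (N ω₀)
    rw [Ideal.Quotient.eq]
    apply hle
    rw [Ideal.mem_torsionOf_iff, smul_eq_mul, sub_mul, mul_comm _ m, mul_comm _ m, hω, hω₀,
      sub_self]

theorem exists_norm_integral_stdAddChar_le (a : ℕ) [NeZero a] {ε : ℝ} (hε : 0 < ε) :
    ∃ ρ : ℝ, 0 < ρ ∧ ρ < 1 ∧ ∀ (Ω : Type v) [MeasurableSpace Ω] (P : Measure Ω)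
      [IsProbabilityMeasure P] (N : Ω → ZMod a), Measurable N → IsBalanced P ε N →
      ∀ m : ZMod a, m ≠ 0 → ‖∫ ω, ZMod.stdAddChar (m * N ω) ∂P‖ ≤ ρ := by
  obtain ⟨η, hη, hre⟩ := exists_re_stdAddChar_le a
  -- The maximum with $1/4$ only keeps `ρ` positive, as its logarithm is taken later.
  refine ⟨√(max (1 - η * ε) (1 / 4)), by positivity, ?_, fun Ω _ P _ N hNm hN m hm => ?_⟩
  · rw [Real.sqrt_lt' one_pos, one_pow]
    have : 0 < η * ε := by positivity
    exact max_lt (by linarith) (by norm_num)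
  · refine Real.le_sqrt_of_sq_le (le_trans ?_ (le_max_left _ _))
    have hmeas : Measurable fun ω => m * N ω := (measurable_of_finite (m * ·)).comp hNm
    have hprob : IsProbabilityMeasure (P.map fun ω => m * N ω) :=
      Measure.isProbabilityMeasure_map hmeas.aemeasurable
    have h1 : ∫ ω, ZMod.stdAddChar (m * N ω) ∂P =
        ∑ s : ZMod a, (((P.map fun ω => m * N ω).real {s} : ℝ) : ℂ) * ZMod.stdAddChar s := by
      rw [← integral_map (φ := fun ω => m * N ω) hmeas.aemeasurable
        (f := fun s => ZMod.stdAddChar s) (measurable_of_finite _).aestronglyMeasurable,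
        integral_fintype .of_finite]
      simp
    rw [h1]
    refine norm_sum_mul_stdAddChar_sq_le hη.le hre (fun s => measureReal_nonneg) ?_ fun s => ?_
    · rw [sum_measureReal_singleton]
      simp
    · rw [map_measureReal_apply hmeas (measurableSet_singleton s)]
      exact hN.measureReal_mul_eq_le hm s

end Balanced

/-! ### The coefficients of the independent entries -/

section Coeff

open Finset
open scoped Classical

theorem sum_upper_eq {M : Type*} [AddCommMonoid M] {n : ℕ} (F : Fin n → Fin n → M) :
    ∑ r : {r : Fin n × Fin n // r.1 ≤ r.2}, F r.1.1 r.1.2 =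
      ∑ i, F i i + ∑ p : Fin n × Fin n with p.1 < p.2, F p.1 p.2 := by
  have h := sum_pairs_eq fun i j => if i ≤ j then F i j else 0
  rw [← Fintype.sum_prod_type' (fun i j => if i ≤ j then F i j else 0), ← sum_filter,
    sum_subtype (p := fun r : Fin n × Fin n => r.1 ≤ r.2) _ (by simp)] at h
  rw [h]
  congr 1
  · simp
  · refine sum_congr rfl fun p hp => ?_
    have hp' := (mem_filter.1 hp).2
    simp [hp'.le, not_le.2 hp']

variable {W A : Type*} [AddCommGroup W] [AddCommGroup A] {n : ℕ}

/-- The coefficient of the entry `(i, j)`, `i ≤ j`, in the phase of the tuple `w`. -/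
noncomputable def coeff (q : W → A) (b : W →+ W →+ A) (w : Fin n → W) (i j : Fin n) : A :=
  if i = j then q (w i) else b (w i) (w j)

theorem coeff_self (q : W → A) (b : W →+ W →+ A) (w : Fin n → W) (i : Fin n) :
    coeff q b w i i = q (w i) := if_pos rfl

theorem coeff_of_lt (q : W → A) (b : W →+ W →+ A) (w : Fin n → W) {i j : Fin n} (h : i < j) :
    coeff q b w i j = b (w i) (w j) := if_neg h.ne

theorem prod_coeff_eq_pow_weight (q : W → A) (b : W →+ W →+ A) (w : Fin n → W) (ρ : ℝ) :
    ∏ r : {r : Fin n × Fin n // r.1 ≤ r.2},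
      (if coeff q b w r.1.1 r.1.2 = 0 then 1 else ρ) = ρ ^ weight q b w := by
  have h1 : weight q b w = ∑ r : {r : Fin n × Fin n // r.1 ≤ r.2},
      if coeff q b w r.1.1 r.1.2 = 0 then 0 else 1 := by
    rw [sum_upper_eq fun i j => if coeff q b w i j = 0 then 0 else 1, weight, card_filter,
      ← filter_filter, card_filter]
    congr 1
    · exact sum_congr rfl fun i _ => by rw [coeff_self, ite_not]
    · refine sum_congr rfl fun p hp => ?_
      rw [coeff_of_lt _ _ _ (mem_filter.1 hp).2, ite_not]
  rw [h1, ← prod_pow_eq_pow_sum]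
  exact prod_congr rfl fun r _ => by split_ifs <;> simp

theorem coeff_eq_zero_of_weight {q : W → A} {b : W →+ W →+ A} {w : Fin n → W}
    (hw : weight q b w = 0) {i j : Fin n} (hij : i ≤ j) : coeff q b w i j = 0 := by
  rw [weight_eq_zero] at hw
  rcases hij.eq_or_lt with rfl | h
  · rw [coeff_self, hw.1]
  · rw [coeff_of_lt _ _ _ h, hw.2 _ _ h]

end Coeff

/-! ### The expected number of surjections over `ZMod a` -/

section Moment

open Finset

variable {a : ℕ} [NeZero a] {G : Type*} [AddCommGroup G] [Module (ZMod a) G] {n : ℕ}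

/-- The number of generating tuples of `G` annihilated by the columns of `X`. -/
noncomputable def solCount (G : Type*) [AddCommGroup G] [Module (ZMod a) G]
    (X : Matrix (Fin n) (Fin n) (ZMod a)) : ℕ :=
  Nat.card {f : Fin n → G // IsGenerating a f ∧ ∀ j, ∑ i, X i j • f i = 0}

variable {Ω : Type*} [MeasurableSpace Ω] {P : Measure Ω} [IsProbabilityMeasure P] {ε : ℝ}
  {C : Matrix (Fin n) (Fin n) (ZMod a)} {X : Ω → Matrix (Fin n) (Fin n) (ZMod a)}

/-- Below the diagonal no measurability is assumed, but there $X_{ij}=X_{ji}-C_{ji}$ almost surely.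
-/
theorem IsBalancedCSymmetric.aemeasurable (hX : IsBalancedCSymmetric P ε C X) :
    AEMeasurable (fun ω i j => X ω i j) P := by
  refine aemeasurable_pi_lambda _ fun i => aemeasurable_pi_lambda _ fun j => ?_
  rcases le_total i j with h | h
  · exact (hX.measurable i j h).aemeasurable
  · refine ⟨fun ω => X ω j i - C j i, (measurable_of_finite (· - C j i)).comp (hX.measurable j i h),
      ?_⟩
    filter_upwards [hX.csymm] with ω hω
    rw [← hω]
    simp

theorem IsBalancedCSymmetric.integrable_comp {E : Type*} [NormedAddCommGroup E]
    (hX : IsBalancedCSymmetric P ε C X) (F : Matrix (Fin n) (Fin n) (ZMod a) → E) :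
    Integrable (fun ω => F (X ω)) P :=
  Integrable.comp_aemeasurable
    (g := fun Y : Fin n → Fin n → ZMod a => F Y)
    (f := fun ω i j => X ω i j) .of_finite hX.aemeasurable

/-- For $i<j$ substitute $X_{ji}=X_{ij}-C_{ij}$: the entry $X_{ij}$ collects
$\varphi_j(f_i)+\varphi_i(f_j)=b(w_i,w_j)$, leaving $-C_{ij}\varphi_i(f_j)$. -/
theorem IsBalancedCSymmetric.phase_eq (hX : IsBalancedCSymmetric P ε C X) (f : Fin n → G)
    (φ : Fin n → Module.Dual (ZMod a) G) :
    ∀ᵐ ω ∂P, ∑ j, φ j (∑ i, X ω i j • f i) =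
      -∑ p : Fin n × Fin n with p.1 < p.2, C p.1 p.2 * φ p.1 (f p.2) +
      ∑ r : {r : Fin n × Fin n // r.1 ≤ r.2},
        coeff hypQuad hypBilin (fun i => (f i, φ i)) r.1.1 r.1.2 * X ω r.1.1 r.1.2 := by
  filter_upwards [hX.csymm] with ω hω
  have hC : ∀ i j, C i j = X ω i j - X ω j i := fun i j => by rw [← hω]; simp
  rw [sum_upper_eq fun i j => coeff hypQuad hypBilin (fun i => (f i, φ i)) i j * X ω i j]
  simp only [map_sum, map_smul, smul_eq_mul]
  rw [sum_pairs_eq, add_left_comm, ← sum_neg_distrib, ← sum_add_distrib]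
  congr 1
  · refine sum_congr rfl fun i _ => ?_
    rw [coeff_self, hypQuad, mul_comm]
  · refine sum_congr rfl fun p hp => ?_
    rw [coeff_of_lt _ _ _ (mem_filter.1 hp).2, hypBilin_apply, hC]
    ring

theorem IsBalancedCSymmetric.integral_prod_stdAddChar (hX : IsBalancedCSymmetric P ε C X)
    (m : Fin n → Fin n → ZMod a) :
    ∫ ω, ∏ r : {r : Fin n × Fin n // r.1 ≤ r.2},
        ZMod.stdAddChar (m r.1.1 r.1.2 * X ω r.1.1 r.1.2) ∂P =
      ∏ r : {r : Fin n × Fin n // r.1 ≤ r.2},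
        ∫ ω, ZMod.stdAddChar (m r.1.1 r.1.2 * X ω r.1.1 r.1.2) ∂P := by
  have hmeas : ∀ s : ZMod a, Measurable fun t : ZMod a => (ZMod.stdAddChar (s * t) : ℂ) :=
    fun s => measurable_of_finite _
  have key := iIndepFun.integral_fun_prod_comp
    (X := fun (r : {r : Fin n × Fin n // r.1 ≤ r.2}) ω => X ω r.1.1 r.1.2)
    (f := fun r s => (ZMod.stdAddChar (m r.1.1 r.1.2 * s) : ℂ)) hX.indep
    (fun r => (hX.measurable _ _ r.2).aemeasurable)
    (fun r => (hmeas _).aestronglyMeasurable)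
  exact key

theorem IsBalancedCSymmetric.integral_stdAddChar_eq (hX : IsBalancedCSymmetric P ε C X)
    (f : Fin n → G) (φ : Fin n → Module.Dual (ZMod a) G) :
    ∫ ω, ZMod.stdAddChar (∑ j, φ j (∑ i, X ω i j • f i)) ∂P =
      ZMod.stdAddChar (-∑ p : Fin n × Fin n with p.1 < p.2, C p.1 p.2 * φ p.1 (f p.2)) *
      ∏ r : {r : Fin n × Fin n // r.1 ≤ r.2}, ∫ ω, ZMod.stdAddChar
        (coeff hypQuad hypBilin (fun i => (f i, φ i)) r.1.1 r.1.2 * X ω r.1.1 r.1.2) ∂P := by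
  have hae : (fun ω => ZMod.stdAddChar (∑ j, φ j (∑ i, X ω i j • f i))) =ᵐ[P] fun ω =>
      ZMod.stdAddChar (-∑ p : Fin n × Fin n with p.1 < p.2, C p.1 p.2 * φ p.1 (f p.2)) *
      ∏ r : {r : Fin n × Fin n // r.1 ≤ r.2}, ZMod.stdAddChar
        (coeff hypQuad hypBilin (fun i => (f i, φ i)) r.1.1 r.1.2 * X ω r.1.1 r.1.2) := by
    filter_upwards [hX.phase_eq f φ] with ω hω
    rw [hω, AddChar.map_add_eq_mul, stdAddChar_sum]
  rw [integral_congr_ae hae, integral_const_mul, hX.integral_prod_stdAddChar]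

theorem IsBalancedCSymmetric.integral_stdAddChar_of_weight_eq_zero
    (hX : IsBalancedCSymmetric P ε C X) {f : Fin n → G} {φ : Fin n → Module.Dual (ZMod a) G}
    (hw : weight hypQuad hypBilin (fun i => (f i, φ i)) = 0) :
    ∫ ω, ZMod.stdAddChar (∑ j, φ j (∑ i, X ω i j • f i)) ∂P =
      ZMod.stdAddChar (-∑ p : Fin n × Fin n with p.1 < p.2, C p.1 p.2 * φ p.1 (f p.2)) := by
  rw [hX.integral_stdAddChar_eq, prod_eq_one, mul_one]
  intro r _
  simp [coeff_eq_zero_of_weight hw r.2]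

theorem IsBalancedCSymmetric.norm_integral_stdAddChar_le (hX : IsBalancedCSymmetric P ε C X)
    {ρ : ℝ} (hρ : ∀ N : Ω → ZMod a, Measurable N → IsBalanced P ε N →
      ∀ m : ZMod a, m ≠ 0 → ‖∫ ω, ZMod.stdAddChar (m * N ω) ∂P‖ ≤ ρ)
    (f : Fin n → G) (φ : Fin n → Module.Dual (ZMod a) G) :
    ‖∫ ω, ZMod.stdAddChar (∑ j, φ j (∑ i, X ω i j • f i)) ∂P‖ ≤
      ρ ^ weight hypQuad hypBilin (fun i => (f i, φ i)) := by
  rw [hX.integral_stdAddChar_eq, norm_mul, norm_stdAddChar, one_mul, norm_prod,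
    ← prod_coeff_eq_pow_weight]
  refine prod_le_prod (fun _ _ => norm_nonneg _) fun r _ => ?_
  split_ifs with h
  · simp [h]
  · exact hρ _ (hX.measurable _ _ r.2) (hX.balanced _ _ r.2) _ h

open scoped Classical in
theorem card_pow_mul_solCount [Fintype G] [Fintype (Module.Dual (ZMod a) G)]
    (Y : Matrix (Fin n) (Fin n) (ZMod a)) :
    (Fintype.card G : ℂ) ^ n * solCount G Y = ∑ f : Fin n → G with IsGenerating a f,
      ∑ φ : Fin n → Module.Dual (ZMod a) G,
        ZMod.stdAddChar (∑ j, φ j (∑ i, Y i j • f i)) := by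
  simp only [sum_stdAddChar_dual_pi (fun j => ∑ i, Y i j • _)]
  rw [← sum_filter, sum_const, nsmul_eq_mul, mul_comm, filter_filter, solCount,
    Nat.card_eq_fintype_card, Fintype.card_subtype]
  simp only [funext_iff, Pi.zero_apply]

/-- The moments of the cokernel of a balanced random `C`-symmetric matrix over `ZMod a`. -/
theorem exists_moment_bound (a : ℕ) [NeZero a] (G : Type u) [AddCommGroup G] [Finite G]
    [Module (ZMod a) G] {ε : ℝ} (hε : 0 < ε) :
    ∃ K c : ℝ, 0 < K ∧ 0 < c ∧
      ∀ (n : ℕ) (C : Matrix (Fin n) (Fin n) (ZMod a)) (h : ℤ) (g : ℕ),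
        IsAlternating C → (∀ i j, (h : ZMod a) ∣ C i j) →
        GeneratesMultiples C (h : ZMod a) g →
        ∀ (Ω : Type v) [MeasurableSpace Ω] (P : Measure Ω) [IsProbabilityMeasure P]
          (X : Ω → Matrix (Fin n) (Fin n) (ZMod a)), IsBalancedCSymmetric P ε C X →
          Integrable (fun ω => (solCount G (X ω) : ℝ)) P ∧
          |∫ ω, (solCount G (X ω) : ℝ) ∂P - (wedgeCard G h : ℝ)| ≤
            K * (Real.exp (-c * n) + (2 : ℝ) ^ ((g : ℤ) - (n : ℤ))) := by
  classical
  obtain ⟨ρ, hρ, hρ1, hchar⟩ := exists_norm_integral_stdAddChar_le.{v} a hε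
  let _ : Fintype G := Fintype.ofFinite G
  let _ : Fintype (Module.Dual (ZMod a) G) := Fintype.ofFinite _
  have : Finite (G →ₗ[ZMod a] Module.Dual (ZMod a) G) := DFunLike.finite _
  let _ : Fintype (AltForm a G) := Fintype.ofFinite _
  have hG : (0 : ℝ) < Fintype.card G := by exact_mod_cast Fintype.card_pos
  obtain ⟨K₁, c, hK₁, hc, hsum⟩ := exists_sum_weight_le (W := G × Module.Dual (ZMod a) G)
    (q := hypQuad) (b := hypBilin) hypBilin_comm hypBilin_self hypQuad_add
    (N := Fintype.card G) Fintype.card_pos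
    (fun L hL => by
      have := card_isotropic L hL
      rwa [Nat.card_eq_fintype_card (α := G)] at this) hρ hρ1
  set K₂ : ℝ := (Fintype.card (AltForm a G) : ℝ) * (1 + Nat.card (Submodule (ZMod a) G)) with hK₂
  have hK₂0 : 0 ≤ K₂ := by positivity
  refine ⟨K₁ + K₂, c, by positivity, hc, fun n C h g hC hdvd hg Ω _ P _ X hX => ?_⟩
  refine ⟨hX.integrable_comp fun Y => (solCount G Y : ℝ), ?_⟩
  set J : (Fin n → G) → (Fin n → Module.Dual (ZMod a) G) → ℂ := fun f φ =>
    ∫ ω, ZMod.stdAddChar (∑ j, φ j (∑ i, X ω i j • f i)) ∂P with hJ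
  have h1 : (Fintype.card G : ℂ) ^ n * ((∫ ω, (solCount G (X ω) : ℝ) ∂P : ℝ) : ℂ) =
      ∑ f : Fin n → G with IsGenerating a f, ∑ φ, J f φ := by
    rw [← integral_complex_ofReal, ← integral_const_mul]
    simp only [Complex.ofReal_natCast, card_pow_mul_solCount]
    rw [integral_finsetSum]
    · refine sum_congr rfl fun f _ => ?_
      rw [integral_finsetSum]
      intro φ _
      exact hX.integrable_comp fun Y => ZMod.stdAddChar (∑ j, φ j (∑ i, Y i j • f i))
    · intro f _
      exact hX.integrable_comp fun Y => ∑ φ : Fin n → Module.Dual (ZMod a) G,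
        ZMod.stdAddChar (∑ j, φ j (∑ i, Y i j • f i))
  have h2 : ∑ f : Fin n → G with IsGenerating a f, ∑ φ, J f φ =
      (∑ f : Fin n → G with IsGenerating a f,
        ∑ φ : Fin n → Module.Dual (ZMod a) G with
          weight hypQuad hypBilin (fun i => (f i, φ i)) = 0,
        ZMod.stdAddChar (-∑ p : Fin n × Fin n with p.1 < p.2, C p.1 p.2 * φ p.1 (f p.2))) +
      ∑ f : Fin n → G with IsGenerating a f,
        ∑ φ : Fin n → Module.Dual (ZMod a) G with
          ¬ weight hypQuad hypBilin (fun i => (f i, φ i)) = 0, J f φ := by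
    rw [← sum_add_distrib]
    refine sum_congr rfl fun f _ => ?_
    rw [← sum_filter_add_sum_filter_not univ (fun φ : Fin n → Module.Dual (ZMod a) G =>
      weight hypQuad hypBilin (fun i => (f i, φ i)) = 0)]
    congr 1
    exact sum_congr rfl fun φ hφ =>
      hX.integral_stdAddChar_of_weight_eq_zero (mem_filter.1 hφ).2
  have h3 : ‖∑ f : Fin n → G with IsGenerating a f,
        ∑ φ : Fin n → Module.Dual (ZMod a) G with
          ¬ weight hypQuad hypBilin (fun i => (f i, φ i)) = 0, J f φ‖ ≤
      K₁ * Real.exp (-c * n) * (Fintype.card G : ℝ) ^ n := by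
    refine le_trans ?_ (hsum n)
    calc _ ≤ ∑ f : Fin n → G with IsGenerating a f,
          ∑ φ : Fin n → Module.Dual (ZMod a) G with
            ¬ weight hypQuad hypBilin (fun i => (f i, φ i)) = 0,
            ρ ^ weight hypQuad hypBilin (fun i => (f i, φ i)) := by
          refine (norm_sum_le _ _).trans (sum_le_sum fun f _ => ?_)
          refine (norm_sum_le _ _).trans (sum_le_sum fun φ _ => ?_)
          exact hX.norm_integral_stdAddChar_le (fun N => hchar Ω P N) f φ
      _ ≤ ∑ f : Fin n → G,
          ∑ φ : Fin n → Module.Dual (ZMod a) G with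
            ¬ weight hypQuad hypBilin (fun i => (f i, φ i)) = 0,
            ρ ^ weight hypQuad hypBilin (fun i => (f i, φ i)) :=
          sum_le_sum_of_subset_of_nonneg (subset_univ _) fun f _ _ =>
            sum_nonneg fun φ _ => by positivity
      _ = _ := by
          simp only [sum_filter]
          rw [← Fintype.sum_prod_type' (f := fun (f : Fin n → G)
            (φ : Fin n → Module.Dual (ZMod a) G) =>
              if ¬ weight hypQuad hypBilin (fun i => (f i, φ i)) = 0 then
                ρ ^ weight hypQuad hypBilin (fun i => (f i, φ i)) else 0)]
          exact Fintype.sum_equiv (Equiv.arrowProdEquivProdArrow (Fin n) (fun _ => G)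
            (fun _ => Module.Dual (ZMod a) G)).symm _ _ fun x => rfl
  have h4 := norm_mainTerm_sub_le (G := G) C hC h hdvd hg
  rw [← hK₂] at h4
  have hGn : (0 : ℝ) < (Fintype.card G : ℝ) ^ n := by positivity
  have h5 : ‖(Fintype.card G : ℂ) ^ n * ((∫ ω, (solCount G (X ω) : ℝ) ∂P : ℝ) : ℂ) -
      (Fintype.card G : ℂ) ^ n * wedgeCard G h‖ ≤
      (Fintype.card G : ℝ) ^ n * (K₂ * 2 ^ ((g : ℤ) - (n : ℤ))) +
        K₁ * Real.exp (-c * n) * (Fintype.card G : ℝ) ^ n := by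
    rw [h1, h2, add_sub_right_comm]
    exact (norm_add_le _ _).trans (add_le_add h4 h3)
  rw [← mul_sub, norm_mul, norm_pow, Complex.norm_natCast, ← Complex.ofReal_natCast (wedgeCard G h),
    ← Complex.ofReal_sub, Complex.norm_real, Real.norm_eq_abs] at h5
  have h6 : |∫ ω, (solCount G (X ω) : ℝ) ∂P - (wedgeCard G h : ℝ)| ≤
      K₂ * 2 ^ ((g : ℤ) - (n : ℤ)) + K₁ * Real.exp (-c * n) := by
    refine le_of_mul_le_mul_left (h5.trans (le_of_eq ?_)) hGn
    ring
  refine h6.trans ?_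
  have e1 : 0 ≤ Real.exp (-c * n) := (Real.exp_pos _).le
  have e2 : (0 : ℝ) ≤ 2 ^ ((g : ℤ) - (n : ℤ)) := by positivity
  nlinarith [mul_nonneg hK₁.le e2, mul_nonneg hK₂0 e1]

end Moment

/-! ### Reduction to `ZMod a` -/

section Reduction

open Finset

variable {R : Type*} [CommRing R] {a : ℕ} [NeZero a] {n : ℕ}

/-- Surjections from the cokernel of `X` onto `G` correspond to generating tuples annihilated by the
columns of the reduction of `X`. -/
theorem numSur_coker_eq (G : Type*) [AddCommGroup G] [Module (ZMod a) G] (π : R →+* ZMod a)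
    (hπ : ∀ r, π r = 0 → (a : R) ∣ r) (X : Matrix (Fin n) (Fin n) R) :
    numSur (Coker X) G = solCount G (X.map π) := by
  let _ : Module R G := Module.compHom G π
  have hsmul : ∀ (r : R) (x : G), r • x = π r • x := fun _ _ => rfl
  -- Additive maps into `G` are automatically `R`-linear: each `r` is an integer plus a multiple of
  -- `a`, and `a` kills `G`.
  have hlin : ∀ (F : Coker X →+ G) (r : R) (y : Coker X), F (r • y) = r • F y := by
    intro F r y
    obtain ⟨s, hs⟩ := hπ (r - ((π r).val : R)) (by simp)
    rw [sub_eq_iff_eq_add] at hs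
    have h1 : F (((a : R) * s) • y) = 0 := by
      rw [mul_smul, Nat.cast_smul_eq_nsmul, map_nsmul, nsmul_eq_zero_of_module (a := a)]
    rw [hsmul, hs, add_smul, map_add, h1, zero_add, Nat.cast_smul_eq_nsmul, map_nsmul, ← hs,
      ← Nat.cast_smul_eq_nsmul (ZMod a), ZMod.natCast_zmod_val]
  let toLin (F : Coker X →+ G) : Coker X →ₗ[R] G := { F with map_smul' := hlin F }
  let gen (F : Coker X →+ G) (i : Fin n) : G := F (Submodule.Quotient.mk (Pi.single i 1))
  have hgen : ∀ F u, F (Submodule.Quotient.mk u) = ∑ i, π (u i) • gen F i := by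
    intro F u
    have h1 : (toLin F).comp (Submodule.mkQ _) = Fintype.linearCombination R (gen F) := by
      ext i
      simp [toLin, gen]
    have h2 := DFunLike.congr_fun h1 u
    rw [Fintype.linearCombination_apply] at h2
    exact h2
  have hspan : ∀ (f : Fin n → G), IsGenerating a f ↔
      Function.Surjective fun u : Fin n → R => ∑ i, π (u i) • f i := by
    intro f
    rw [IsGenerating, ← Fintype.range_linearCombination, LinearMap.range_eq_top]
    have hπs : Function.Surjective π := ZMod.ringHom_surjective π
    constructor
    · intro h x
      obtain ⟨u, hu⟩ := h x
      choose u' hu' using fun i => hπs (u i)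
      refine ⟨u', ?_⟩
      simp only [hu']
      rw [← hu, Fintype.linearCombination_apply]
    · intro h x
      obtain ⟨u, hu⟩ := h x
      exact ⟨fun i => π (u i), by rw [Fintype.linearCombination_apply]; exact hu⟩
  rw [numSur, solCount]
  refine Nat.card_congr (Equiv.ofBijective (fun F => ⟨gen F.1, ?_, fun j => ?_⟩) ⟨?_, ?_⟩)
  · rw [hspan]
    intro x
    obtain ⟨y, hy⟩ := F.2 x
    obtain ⟨u, rfl⟩ := Submodule.Quotient.mk_surjective _ y
    exact ⟨u, by rw [← hy, hgen]⟩
  · have h1 : (Submodule.Quotient.mk (X.mulVec (Pi.single j 1)) : Coker X) = 0 :=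
      (Submodule.Quotient.mk_eq_zero _).2 ⟨Pi.single j 1, rfl⟩
    have h2 := hgen F.1 (X.mulVec (Pi.single j 1))
    rw [h1, map_zero] at h2
    rw [h2]
    simp
  · intro F F' h
    have h1 : gen F.1 = gen F'.1 := congrArg Subtype.val h
    refine Subtype.ext (DFunLike.ext _ _ fun y => ?_)
    obtain ⟨u, rfl⟩ := Submodule.Quotient.mk_surjective _ y
    rw [hgen, hgen, h1]
  · rintro ⟨f, hf, hfX⟩
    have hle : LinearMap.range X.mulVecLin ≤ LinearMap.ker (Fintype.linearCombination R f) := by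
      rintro _ ⟨z, rfl⟩
      rw [LinearMap.mem_ker, Fintype.linearCombination_apply]
      simp only [Matrix.mulVecLin_apply, Matrix.mulVec, dotProduct, hsmul, map_sum, map_mul,
        sum_smul]
      rw [sum_comm]
      refine sum_eq_zero fun j _ => ?_
      have := congrArg (π (z j) • ·) (hfX j)
      simp only [smul_sum, smul_zero, Matrix.map_apply, smul_smul] at this
      rw [← this]
      exact sum_congr rfl fun i _ => by rw [mul_comm]
    let F : Coker X →ₗ[R] G := Submodule.liftQ _ (Fintype.linearCombination R f) hle
    have hF : ∀ u, F (Submodule.Quotient.mk u) = ∑ i, π (u i) • f i := fun u => by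
      change Fintype.linearCombination R f u = _
      rw [Fintype.linearCombination_apply]
      rfl
    refine ⟨⟨F.toAddMonoidHom, fun x => ?_⟩, Subtype.ext (funext fun i => ?_)⟩
    · obtain ⟨u, hu⟩ := (hspan f).1 hf x
      exact ⟨Submodule.Quotient.mk u, (hF u).trans hu⟩
    · change F (Submodule.Quotient.mk (Pi.single i 1)) = f i
      rw [hF]
      simp [Pi.single_apply]

/-- Lifting a relation from $R/R[h]$ to $R$ leaves an error in $R[h]$, which multiplication by `h`
kills. The outcome mentions only `C` and `h`, so it survives reduction to $\mathbb Z/a$, where the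
torsion of `h` may grow. -/
theorem GeneratedBy.generatesMultiples {C : Matrix (Fin n) (Fin n) R} {h : R}
    {hC : ∀ i j, h ∣ C i j} {g : ℕ}
    (hg : GeneratedBy (ModTorsion R h) (Coker (divBy C h hC)) g) : GeneratesMultiples C h g := by
  obtain ⟨v, hv⟩ := hg
  have hmk : Function.Surjective (Ideal.Quotient.mk (Ideal.torsionOf R R h)) :=
    Ideal.Quotient.mk_surjective
  choose v' hv' using fun k => Submodule.Quotient.mk_surjective _ (v k)
  choose w hw using fun k i => hmk (v' k i)
  refine ⟨w, fun u => ?_⟩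
  have hu : (Submodule.Quotient.mk (fun i => Ideal.Quotient.mk (Ideal.torsionOf R R h) (u i)) :
      Coker (divBy C h hC)) ∈ Submodule.span (ModTorsion R h) (Set.range v) := by
    rw [hv]; trivial
  obtain ⟨c, hc⟩ := (Submodule.mem_span_range_iff_exists_fun _).1 hu
  choose c' hc' using fun k => hmk (c k)
  have h1 : (Submodule.Quotient.mk ((fun i => Ideal.Quotient.mk (Ideal.torsionOf R R h) (u i)) -
      ∑ k, c k • v' k) : Coker (divBy C h hC)) = 0 := by
    rw [Submodule.Quotient.mk_sub, ← hc, sub_eq_zero, ← Submodule.mkQ_apply, map_sum]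
    refine sum_congr rfl fun k _ => ?_
    rw [map_smul, Submodule.mkQ_apply, hv']
  obtain ⟨z, hz⟩ := (Submodule.Quotient.mk_eq_zero _).1 h1
  choose z' hz' using fun j => hmk (z j)
  refine ⟨c', z', fun i => ?_⟩
  have h2 := congrFun hz i
  simp only [Matrix.mulVecLin_apply, Matrix.mulVec, dotProduct, divBy, Pi.sub_apply,
    Finset.sum_apply, Pi.smul_apply, smul_eq_mul, ← hz', ← hc', ← hw, ← map_mul, ← map_sum,
    ← map_sub] at h2
  rw [Ideal.Quotient.eq, Ideal.mem_torsionOf_iff, smul_eq_mul] at h2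
  have h3 : ∑ j, C i j * z' j = h * ∑ j, (hC i j).choose * z' j := by
    rw [mul_sum]
    refine sum_congr rfl fun j _ => ?_
    rw [← mul_assoc, ← (hC i j).choose_spec]
  rw [h3]
  linear_combination -h2

theorem GeneratesMultiples.map {S : Type*} [CommRing S] {C : Matrix (Fin n) (Fin n) R} {h : R}
    {g : ℕ} (hg : GeneratesMultiples C h g) (π : R →+* S) (hπ : Function.Surjective π) :
    GeneratesMultiples (C.map π) (π h) g := by
  obtain ⟨v, hv⟩ := hg
  refine ⟨fun k i => π (v k i), fun u => ?_⟩
  choose u' hu' using fun i => hπ (u i)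
  obtain ⟨c, z, hcz⟩ := hv u'
  refine ⟨fun k => π (c k), fun j => π (z j), fun i => ?_⟩
  have := congrArg π (hcz i)
  simpa [hu'] using this

theorem IsAlternating.map {S : Type*} [CommRing S] {C : Matrix (Fin n) (Fin n) R}
    (hC : IsAlternating C) (π : R →+* S) : IsAlternating (C.map π) := by
  refine ⟨?_, fun i => by rw [Matrix.map_apply, hC.2, map_zero]⟩
  ext i j
  have := congrArg π (congrFun (congrFun hC.1 i) j)
  simpa using this

theorem IsBalanced.map {S : Type*} [CommRing S] {Ω : Type*} [MeasurableSpace Ω] {P : Measure Ω}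
    {ε : ℝ} {N : Ω → R} (hN : IsBalanced P ε N) (π : R →+* S) (hπ : Function.Surjective π) :
    IsBalanced P ε fun ω => π (N ω) := by
  intro 𝔭 h𝔭 r
  obtain ⟨s, rfl⟩ := Ideal.Quotient.mk_surjective r
  obtain ⟨t, rfl⟩ := hπ s
  convert hN (𝔭.comap π) (Ideal.comap_isMaximal_of_surjective π hπ) (Ideal.Quotient.mk _ t)
    using 3
  ext ω
  change Ideal.Quotient.mk 𝔭 _ = _ ↔ Ideal.Quotient.mk (𝔭.comap π) _ = _
  rw [Ideal.Quotient.eq, Ideal.Quotient.eq, Ideal.mem_comap, map_sub]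

theorem IsBalancedCSymmetric.map {S : Type*} [CommRing S] [MeasurableSpace R] [MeasurableSpace S]
    {Ω : Type*} [MeasurableSpace Ω] {P : Measure Ω} {ε : ℝ} {C : Matrix (Fin n) (Fin n) R}
    {X : Ω → Matrix (Fin n) (Fin n) R} (hX : IsBalancedCSymmetric P ε C X) (π : R →+* S)
    (hπ : Function.Surjective π) (hm : Measurable π) :
    IsBalancedCSymmetric P ε (C.map π) fun ω => (X ω).map π where
  csymm := by
    filter_upwards [hX.csymm] with ω hω
    ext i j
    rw [← hω]
    simp
  measurable i j hij := hm.comp (hX.measurable i j hij)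
  indep := hX.indep.comp (fun _ => π) fun _ => hm
  balanced i j hij := (hX.balanced i j hij).map π hπ

theorem tendsto_two_zpow_sub {g : ℕ → ℕ}
    (hg : Tendsto (fun n : ℕ => (n : ℤ) - (g n : ℤ)) atTop atTop) :
    Tendsto (fun n : ℕ => (2 : ℝ) ^ ((g n : ℤ) - (n : ℤ))) atTop (𝓝 0) := by
  have h1 : ∀ n : ℕ, (2 : ℝ) ^ ((g n : ℤ) - (n : ℤ)) =
      Real.exp (-(Real.log 2 * (((n : ℤ) - (g n : ℤ) : ℤ) : ℝ))) := by
    intro n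
    rw [← mul_neg, ← Int.cast_neg, neg_sub, ← Real.rpow_def_of_pos two_pos, Real.rpow_intCast]
  simp only [h1]
  refine Real.tendsto_exp_neg_atTop_nhds_zero.comp ?_
  exact (tendsto_intCast_atTop_atTop.comp hg).const_mul_atTop (Real.log_pos one_lt_two)

/-- Convergence of the moments over a ring with a reduction map to `ZMod a`. -/
theorem tendsto_moment [MeasurableSpace R] (G : Type u) [AddCommGroup G] [Finite G]
    (hG : ∀ x : G, a • x = 0) (π : R →+* ZMod a) (hπ : ∀ r, π r = 0 → (a : R) ∣ r)
    (hm : Measurable π) {ε : ℝ} (hε : 0 < ε) (C : ∀ n : ℕ, Matrix (Fin n) (Fin n) R) (h : ℤ)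
    (g : ℕ → ℕ) (hC : ∀ n, IsAlternating (C n)) (hdvd : ∀ n i j, (h : R) ∣ C n i j)
    (hgen : ∀ n, GeneratedBy (ModTorsion R h) (Coker (divBy (C n) (h : R) (hdvd n))) (g n))
    (Ω : ℕ → Type v) [∀ n, MeasurableSpace (Ω n)] (P : ∀ n, Measure (Ω n))
    [∀ n, IsProbabilityMeasure (P n)] (X : ∀ n, Ω n → Matrix (Fin n) (Fin n) R)
    (hX : ∀ n, IsBalancedCSymmetric (P n) ε (C n) (X n))
    (hlim : Tendsto (fun n : ℕ => (n : ℤ) - (g n : ℤ)) atTop atTop) :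
    (∀ n, Integrable (fun ω => (numSur (Coker (X n ω)) G : ℝ)) (P n)) ∧
    Tendsto (fun n => ∫ ω, (numSur (Coker (X n ω)) G : ℝ) ∂(P n)) atTop
      (𝓝 (wedgeCard G h : ℝ)) := by
  let _ : Module (ZMod a) G := AddCommGroup.zmodModule hG
  have hπs : Function.Surjective π := ZMod.ringHom_surjective π
  obtain ⟨K, c, hK, hc, H⟩ := exists_moment_bound.{u, v} a G hε
  have key : ∀ n, _ := fun n => H n ((C n).map π) h (g n) ((hC n).map π)
    (fun i j => by simpa using map_dvd π (hdvd n i j))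
    (by simpa using (hgen n).generatesMultiples.map π hπs) (Ω n) (P n) (fun ω => (X n ω).map π)
    ((hX n).map π hπs hm)
  simp only [numSur_coker_eq G π hπ]
  refine ⟨fun n => (key n).1, ?_⟩
  rw [tendsto_iff_dist_tendsto_zero]
  refine squeeze_zero (fun _ => dist_nonneg) (fun n => (key n).2) ?_
  rw [show (0 : ℝ) = K * (0 + 0) by ring]
  refine Tendsto.const_mul K (Tendsto.add ?_ (tendsto_two_zpow_sub hlim))
  have : ∀ n : ℕ, Real.exp (-c * n) = Real.exp (-(c * n)) := fun n => by rw [neg_mul]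
  simp only [this]
  exact Real.tendsto_exp_neg_atTop_nhds_zero.comp
    (tendsto_natCast_atTop_atTop.const_mul_atTop hc)

/-- The fibres are open: each contains the ball of radius $p^{-k}$ around any of its points. -/
theorem measurable_toZModPow (p : ℕ) [Fact p.Prime] (k : ℕ) :
    Measurable (PadicInt.toZModPow (p := p) k) := by
  have : NeZero (p ^ k) := ⟨pow_ne_zero _ (Fact.out : p.Prime).ne_zero⟩
  have : BorelSpace ℤ_[p] := ⟨rfl⟩
  refine measurable_to_countable' fun z => IsOpen.measurableSet ?_
  rw [Metric.isOpen_iff]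
  intro x hx
  refine ⟨(p : ℝ) ^ (-k : ℤ), zpow_pos (by exact_mod_cast (Fact.out : p.Prime).pos) _, ?_⟩
  intro y hy
  rw [Metric.mem_ball, dist_eq_norm] at hy
  have h1 := (PadicInt.norm_le_pow_iff_mem_span_pow (y - x) k).1 hy.le
  rw [← PadicInt.ker_toZModPow, RingHom.mem_ker, map_sub, sub_eq_zero] at h1
  exact h1.trans hx

end Reduction

end CSym

/-! ### Assembly over $\mathbb Z/a$, $\mathbb Z$ and $\mathbb Z_p$ -/

theorem mainTheorem2 :
    -- the quantitative bound over `ℤ / a`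
    (∀ (a : ℕ), 0 < a → ∀ (G : Type u) [AddCommGroup G] [Finite G],
      AddMonoid.exponent G ∣ a → ∀ ε : ℝ, 0 < ε →
      ∃ K c : ℝ, 0 < K ∧ 0 < c ∧
        ∀ (n : ℕ) (C : Matrix (Fin n) (Fin n) (ZMod a)) (h : ℤ) (g : ℕ),
          CSym.IsAlternating C →
          ∀ hgcd : CSym.IsGCDOfEntries (h : ZMod a) C,
          CSym.GeneratedBy (CSym.ModTorsion (ZMod a) h)
            (CSym.Coker (CSym.divBy C (h : ZMod a) hgcd.1)) g →
          ∀ (Ω : Type v) [MeasurableSpace Ω] (P : Measure Ω) [IsProbabilityMeasure P]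
            (X : Ω → Matrix (Fin n) (Fin n) (ZMod a)),
            CSym.IsBalancedCSymmetric P ε C X →
            Integrable (fun ω => (CSym.numSur (CSym.Coker (X ω)) G : ℝ)) P ∧
            |∫ ω, (CSym.numSur (CSym.Coker (X ω)) G : ℝ) ∂P - (CSym.wedgeCard G h : ℝ)| ≤
              K * (Real.exp (-c * n) + (2 : ℝ) ^ ((g : ℤ) - (n : ℤ)))) ∧
    -- convergence of the moments over `ℤ / a`
    (∀ (a : ℕ), 0 < a → ∀ (G : Type u) [AddCommGroup G] [Finite G],
      AddMonoid.exponent G ∣ a → ∀ ε : ℝ, 0 < ε →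
      ∀ (C : ∀ n : ℕ, Matrix (Fin n) (Fin n) (ZMod a)) (h : ℤ) (g : ℕ → ℕ),
        (∀ n, CSym.IsAlternating (C n)) →
        ∀ hdvd : ∀ n i j, (h : ZMod a) ∣ C n i j,
        (∀ n, CSym.GeneratedBy (CSym.ModTorsion (ZMod a) h)
          (CSym.Coker (CSym.divBy (C n) (h : ZMod a) (hdvd n))) (g n)) →
        ∀ (Ω : ℕ → Type v) [∀ n, MeasurableSpace (Ω n)] (P : ∀ n, Measure (Ω n))
          [∀ n, IsProbabilityMeasure (P n)]
          (X : ∀ n, Ω n → Matrix (Fin n) (Fin n) (ZMod a)),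
          (∀ n, CSym.IsBalancedCSymmetric (P n) ε (C n) (X n)) →
          Tendsto (fun n : ℕ => (n : ℤ) - (g n : ℤ)) atTop atTop →
          (∀ n, Integrable (fun ω => (CSym.numSur (CSym.Coker (X n ω)) G : ℝ)) (P n)) ∧
          Tendsto (fun n => ∫ ω, (CSym.numSur (CSym.Coker (X n ω)) G : ℝ) ∂(P n)) atTop
            (𝓝 (CSym.wedgeCard G h : ℝ))) ∧
    -- convergence of the moments over `ℤ`
    (∀ (G : Type u) [AddCommGroup G] [Finite G], ∀ ε : ℝ, 0 < ε →
      ∀ (C : ∀ n : ℕ, Matrix (Fin n) (Fin n) ℤ) (h : ℤ) (g : ℕ → ℕ),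
        (∀ n, CSym.IsAlternating (C n)) →
        ∀ hdvd : ∀ n i j, h ∣ C n i j,
        (∀ n, CSym.GeneratedBy (CSym.ModTorsion ℤ h)
          (CSym.Coker (CSym.divBy (C n) h (hdvd n))) (g n)) →
        ∀ (Ω : ℕ → Type v) [∀ n, MeasurableSpace (Ω n)] (P : ∀ n, Measure (Ω n))
          [∀ n, IsProbabilityMeasure (P n)]
          (X : ∀ n, Ω n → Matrix (Fin n) (Fin n) ℤ),
          (∀ n, CSym.IsBalancedCSymmetric (P n) ε (C n) (X n)) →
          Tendsto (fun n : ℕ => (n : ℤ) - (g n : ℤ)) atTop atTop →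
          (∀ n, Integrable (fun ω => (CSym.numSur (CSym.Coker (X n ω)) G : ℝ)) (P n)) ∧
          Tendsto (fun n => ∫ ω, (CSym.numSur (CSym.Coker (X n ω)) G : ℝ) ∂(P n)) atTop
            (𝓝 (CSym.wedgeCard G h : ℝ))) ∧
    -- convergence of the moments over `ℤ_p`
    (∀ (p : ℕ) [Fact p.Prime] (G : Type u) [AddCommGroup G] [Finite G],
      (∃ k : ℕ, Nat.card G = p ^ k) → ∀ ε : ℝ, 0 < ε →
      ∀ (C : ∀ n : ℕ, Matrix (Fin n) (Fin n) ℤ_[p]) (h : ℤ) (g : ℕ → ℕ),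
        (∀ n, CSym.IsAlternating (C n)) →
        ∀ hdvd : ∀ n i j, (h : ℤ_[p]) ∣ C n i j,
        (∀ n, CSym.GeneratedBy (CSym.ModTorsion ℤ_[p] h)
          (CSym.Coker (CSym.divBy (C n) (h : ℤ_[p]) (hdvd n))) (g n)) →
        ∀ (Ω : ℕ → Type v) [∀ n, MeasurableSpace (Ω n)] (P : ∀ n, Measure (Ω n))
          [∀ n, IsProbabilityMeasure (P n)]
          (X : ∀ n, Ω n → Matrix (Fin n) (Fin n) ℤ_[p]),
          (∀ n, CSym.IsBalancedCSymmetric (P n) ε (C n) (X n)) →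
          Tendsto (fun n : ℕ => (n : ℤ) - (g n : ℤ)) atTop atTop →
          (∀ n, Integrable (fun ω => (CSym.numSur (CSym.Coker (X n ω)) G : ℝ)) (P n)) ∧
          Tendsto (fun n => ∫ ω, (CSym.numSur (CSym.Coker (X n ω)) G : ℝ) ∂(P n)) atTop
            (𝓝 (CSym.wedgeCard G h : ℝ))) := by
  refine ⟨?_, ?_, ?_, ?_⟩
  · intro a ha G _ _ hG ε hε
    have : NeZero a := ⟨ha.ne'⟩
    have hG' : ∀ x : G, a • x = 0 := AddMonoid.exponent_dvd_iff_forall_nsmul_eq_zero.1 hG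
    let _ : Module (ZMod a) G := AddCommGroup.zmodModule hG'
    obtain ⟨K, c, hK, hc, H⟩ := CSym.exists_moment_bound.{u, v} a G hε
    refine ⟨K, c, hK, hc, fun n C h g hC hgcd hgen Ω _ P _ X hX => ?_⟩
    have hnum : ∀ ω, CSym.numSur (CSym.Coker (X ω)) G = CSym.solCount G (X ω) := fun ω =>
      CSym.numSur_coker_eq G (RingHom.id (ZMod a))
        (fun r hr => by rw [RingHom.id_apply] at hr; rw [hr]; exact dvd_zero _) (X ω)
    simp only [hnum]
    exact H n C h g hC hgcd.1 hgen.generatesMultiples Ω P X hX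
  · intro a ha G _ _ hG ε hε C h g hC hdvd hgen Ω _ P _ X hX hlim
    have : NeZero a := ⟨ha.ne'⟩
    exact CSym.tendsto_moment G (AddMonoid.exponent_dvd_iff_forall_nsmul_eq_zero.1 hG)
      (RingHom.id (ZMod a))
      (fun r hr => by rw [RingHom.id_apply] at hr; rw [hr]; exact dvd_zero _) measurable_id hε C h g
      hC hdvd hgen Ω P X hX hlim
  · intro G _ _ ε hε C h g hC hdvd hgen Ω _ P _ X hX hlim
    -- Any positive integer killing `G` serves as modulus; here it is the order of `G`, which for
    -- the $p$-adic case is a power of $p$.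
    have : NeZero (Nat.card G) := ⟨Nat.card_pos.ne'⟩
    exact CSym.tendsto_moment (a := Nat.card G) G (fun x => card_nsmul_eq_zero')
      (Int.castRingHom (ZMod (Nat.card G)))
      (fun r hr => by
        have := (ZMod.intCast_zmod_eq_zero_iff_dvd r (Nat.card G)).1 hr
        exact_mod_cast this)
      (measurable_of_countable _) hε C h g hC hdvd hgen Ω P X hX hlim
  · intro p _ G _ _ hG ε hε C h g hC hdvd hgen Ω _ P _ X hX hlim
    obtain ⟨k, hk⟩ := hG
    have : NeZero (p ^ k) := ⟨pow_ne_zero _ (Fact.out : p.Prime).ne_zero⟩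
    refine CSym.tendsto_moment (a := p ^ k) G (fun x => by rw [← hk]; exact card_nsmul_eq_zero')
      (PadicInt.toZModPow k) (fun r hr => ?_) (CSym.measurable_toZModPow p k) hε C h g
      hC hdvd hgen Ω P X hX hlim
    rw [← RingHom.mem_ker, PadicInt.ker_toZModPow, Ideal.mem_span_singleton] at hr
    exact_mod_cast hr
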